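/- **Conventions.** Let $\Sigma$ be a finite totally ordered alphabet and let $\prec$ be the co-lexicographic order on $\Sigma^*$ (strings are compared from right to left; $\preceq$ is its reflexive closure). Automata are finite, have one initial state $q_0$, and are trimmed (every state is reachable from $q_0$ and reaches a final state). A DFA has at most one transition per state and letter. $I_q$ is the set of strings that lead from $q_0$ to $q$. A Wheeler NFA is an NFA with a strict linear order $<$ on its states such that $q_0$ is the minimum and has no incoming edge, and for all $v_1\in\delta(u_1,a_1)$, $v_2\in\delta(u_2,a_2)$: $a_1\prec a_2$ implies $v_1<v_2$; and $a_1=a_2$, $u_1<u_2$ imply $v_1\le v_2$. A WDFA is a deterministic Wheeler NFA. A language is Wheeler if some Wheeler NFA recognizes it. The minimum DFA (WDFA) of a language is a DFA (WDFA) recognizing it with the least number of states. For a language $L$ let $\mathrm{Pref}(L)$ be the set of prefixes of its strings, let $\alpha\equiv_L\beta$ mean that $\{\gamma:\alpha\gamma\in L\}=\{\gamma:\beta\gamma\in L\}$, and let $\mathrm{end}(\alpha)$ be the last letter of $\alpha$, where $\mathrm{end}(\varepsilon)$ is an extra symbol smaller than all letters. For $\alpha,\beta\in \mathrm{Pref}(L)$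 let $\alpha\equiv^c_L\beta$ mean that $\alpha\equiv_L\beta$, $\mathrm{end}(\alpha)=\mathrm{end}(\beta)$, and $\alpha\equiv_L\gamma\equiv_L\beta$ for every $\gamma\in\mathrm{Pref}(L)$ with $\min(\alpha,\beta)\preceq\gamma\preceq\max(\alpha,\beta)$. A *fingerprint* of $L$ is a finite subset of $\mathrm{Pref}(L)$ that contains exactly one element of each $\equiv^c_L$-class. **Algorithm.** The input is a DFA $D$ with $n$ states. Call a string *short* if its length is at most $n^2+n$. 1. Let $\tau$ be the set of the pairs $(m_q,M_q)$, $q$ a state of $D$, where $m_q$ and $M_q$ are the smallest and the greatest short string in $I_q$. 2. While there are $(m,M),(m',M')\in\tau$ with $m\prec m'\prec M$: choose such pairs; let $q$ be the state reached by $m$; let $M_1$ be the greatest short string in $I_q$ smaller than $m'$, and $m_2$ the smallest short string in $I_q$ greater than $m'$; replace $(m,M)$ in $\tau$ by the two pairs $(m,M_1)$ and $(m_2,M)$. 3. (Expand.) Keep each $(m,M)\in\tau$ with $\mathrm{end}(m)=\mathrm{end}(M)$. Replace each other $(m,M)\in\tau$ by $(m,m)$, $(M,M)$ and, for each letter $c$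 with $\mathrm{end}(m)\prec c\prec\mathrm{end}(M)$ for which some string ending with $c$ leads to the state reached by $m$, by one pair $(\alpha_c,\alpha_c)$, where $\alpha_c$ is any such string. 4. Return the set of the first components of the pairs in $\tau$. **Construction from a finite set $F$ of strings.** The states are the elements of $F$; the initial state is the smallest one; $\alpha$ is final iff $\alpha\in L$. For $\alpha\in F$ and $c\in\Sigma$ there is no $c$-transition from $\alpha$ if $x:=\alpha c\notin\mathrm{Pref}(L)$; otherwise $\delta(\alpha,c)$ is found as follows. If $x\preceq\min F$ it is $\min F$; if $\max F\preceq x$ it is $\max F$; if $s\preceq x\preceq t$ with $s\prec t$ consecutive elements of $F$, it is $s$ if $s\equiv_L x\not\equiv_L t$, it is $t$ if $s\not\equiv_L x\equiv_L t$, and if $s\equiv_L x\equiv_L t$ it is the one of $s,t$ whose last letter is $\mathrm{end}(x)=c$. **Theorem.** Let $L$ be a Wheeler language and let $D$ be a minimum DFA of $L$. Then, on input $D$ and for all choices made by the algorithm: - the algorithm terminates: there is no infinite run, and no run gets stuck before it returns; in particular the strings required in step 1 exist, and in every iteration of step 2 the strings $M_1$ and $m_2$ exist for every choice of the pairs; -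 every set $F$ that it returns is a fingerprint of $L$; - for every set $F$ that it returns, the automaton constructed from $F$ is the minimum WDFA of $L$, that is, a WDFA recognizing $L$ with the least number of states. -/

import Mathlib

namespace Wheeler

section Strings

variable {A : Type*} [LinearOrder A]

/-- The strict co-lexicographic order on strings: compare the strings read from right to left. -/
def ColexLt (α β : List A) : Prop := α.reverse < β.reverse

/-- The non-strict co-lexicographic order on strings. -/
def ColexLe (α β : List A) : Prop := ColexLt α β ∨ α = β

/-- The set of prefixes of the strings of `L`. -/
def Pref (L : Language A) : Set (List A) := {α | ∃ β, α ++ β ∈ L}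

/-- Myhill-Nerode equivalence: equality of the right contexts `α⁻¹L` and `β⁻¹L`. -/
def MNEquiv (L : Language A) (α β : List A) : Prop := L.leftQuotient α = L.leftQuotient β

/-- The input-consistent, convex refinement of the Myhill-Nerode equivalence. The last letter of
a string is `List.getLast?`, with value `none` exactly at the empty string. -/
def ConvEquiv (L : Language A) (α β : List A) : Prop :=
  MNEquiv L α β ∧ α.getLast? = β.getLast? ∧
    ∀ γ ∈ Pref L, (ColexLe α γ ∧ ColexLe γ β ∨ ColexLe β γ ∧ ColexLe γ α) →
      MNEquiv L α γ ∧ MNEquiv L γ β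

/-- The Wheeler classes of `L`: the classes of `ConvEquiv L` on the prefixes of `L`. -/
def wheelerClasses (L : Language A) : Set (Set (List A)) :=
  {C | ∃ α ∈ Pref L, C = {β | β ∈ Pref L ∧ ConvEquiv L α β}}

/-- A fingerprint of `L`: a finite set of strings, all lying in Wheeler classes, that meets each
Wheeler class in exactly one string. -/
def IsFingerprint (L : Language A) (F : Finset (List A)) : Prop :=
  (∀ α ∈ F, ∃ C ∈ wheelerClasses L, α ∈ C) ∧
    ∀ C ∈ wheelerClasses L, ((F : Set (List A)) ∩ C).ncard = 1

end Strings

section Automata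

variable {A : Type*} {σ : Type*}

/-- The incoming language of a state. -/
def incoming (M : NFA A σ) (q : σ) : Set (List A) := {α | q ∈ M.eval α}

/-- One initial state, and trimmed: every state is reachable from the initial state and reaches a
final state. -/
def IsTrimmedAutomaton (M : NFA A σ) : Prop :=
  (∃ q₀, M.start = {q₀}) ∧ (∀ q, ∃ α, q ∈ M.eval α) ∧
    ∀ q, ∃ α, ∃ f ∈ M.accept, f ∈ M.evalFrom {q} α

/-- Deterministic automata; the transition function may be partial. -/
def IsDFA (M : NFA A σ) : Prop :=
  IsTrimmedAutomaton M ∧ ∀ q a, (M.step q a).Subsingleton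

/-- `M` is a DFA with the least number of states among the DFAs for its language. -/
def IsMinDFA [Fintype σ] (M : NFA A σ) : Prop :=
  IsDFA M ∧ ∀ (ρ : Type) [Fintype ρ] (N : NFA A ρ),
    IsDFA N → N.accepts = M.accepts → Fintype.card σ ≤ Fintype.card ρ

/-- The strict linear order `lt` makes `M` a Wheeler NFA. -/
def IsWheelerOrder [LinearOrder A] (M : NFA A σ) (lt : σ → σ → Prop) : Prop :=
  IsStrictTotalOrder σ lt ∧
  (∀ q₀ ∈ M.start, (∀ q, q ≠ q₀ → lt q₀ q) ∧ ∀ q a, q₀ ∉ M.step q a) ∧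
  ∀ u₁ u₂ a₁ a₂ v₁ v₂, v₁ ∈ M.step u₁ a₁ → v₂ ∈ M.step u₂ a₂ →
    (a₁ < a₂ → lt v₁ v₂) ∧ (a₁ = a₂ ∧ lt u₁ u₂ → lt v₁ v₂ ∨ v₁ = v₂)

/-- Wheeler NFAs. -/
def IsWNFA [LinearOrder A] (M : NFA A σ) : Prop :=
  IsTrimmedAutomaton M ∧ ∃ lt : σ → σ → Prop, IsWheelerOrder M lt

/-- Wheeler DFAs. -/
def IsWDFA [LinearOrder A] (M : NFA A σ) : Prop :=
  IsDFA M ∧ ∃ lt : σ → σ → Prop, IsWheelerOrder M lt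

/-- `L` is recognized by some finite Wheeler NFA. -/
def IsWheelerLanguage [LinearOrder A] (L : Language A) : Prop :=
  ∃ (ρ : Type) (_ : Fintype ρ) (N : NFA A ρ), IsWNFA N ∧ N.accepts = L

/-- `M` is a WDFA for `L` with the least number of states among the WDFAs for `L`. -/
def IsMinWDFA [LinearOrder A] [Fintype σ] (L : Language A) (M : NFA A σ) : Prop :=
  IsWDFA M ∧ M.accepts = L ∧ ∀ (ρ : Type) [Fintype ρ] (N : NFA A ρ),
    IsWDFA N → N.accepts = L → Fintype.card σ ≤ Fintype.card ρ

end Automata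

section Algorithm

variable {A : Type*} [LinearOrder A] {σ : Type*} [Fintype σ]

/-- The strings of length at most `n² + n` in the incoming language of `q`, where `n` is the
number of states. -/
def shortIncoming (D : NFA A σ) (q : σ) : Set (List A) :=
  {α | α ∈ incoming D q ∧ α.length ≤ Fintype.card σ ^ 2 + Fintype.card σ}

/-- `x` is the co-lexicographically smallest element of `S`. -/
def IsColexMin (S : Set (List A)) (x : List A) : Prop := x ∈ S ∧ ∀ y ∈ S, ColexLe x y

/-- `x` is the co-lexicographically greatest element of `S`. -/
def IsColexMax (S : Set (List A)) (x : List A) : Prop := x ∈ S ∧ ∀ y ∈ S, ColexLe y x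

/-- `τ` is the output of `MinMaxPairs(D)`: for each state, the pair formed by the smallest and
the greatest short string of its incoming language. -/
def IsMinMaxPairs (D : NFA A σ) (τ : Finset (List A × List A)) : Prop :=
  ∃ m M : σ → List A,
    (∀ q, IsColexMin (shortIncoming D q) (m q) ∧ IsColexMax (shortIncoming D q) (M q)) ∧
    τ = Finset.univ.image fun q => (m q, M q)

/-- `x` is the output of `GreatestSmaller(m, m', D)`: the greatest short string smaller than `m'`
in the incoming language of the state reached by `m`. -/
def IsGreatestSmaller (D : NFA A σ) (m m' x : List A) : Prop :=
  ∃ q, m ∈ incoming D q ∧ IsColexMax {y | y ∈ shortIncoming D q ∧ ColexLt y m'} x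

/-- `x` is the output of `SmallestGreater(m, m', D)`: the smallest short string greater than `m'`
in the incoming language of the state reached by `m`. -/
def IsSmallestGreater (D : NFA A σ) (m m' x : List A) : Prop :=
  ∃ q, m ∈ incoming D q ∧ IsColexMin {y | y ∈ shortIncoming D q ∧ ColexLt m' y} x

/-- `α` ends with `c` and enters the same state of `D` as `m`. -/
def EndsAt (D : NFA A σ) (m : List A) (c : A) (α : List A) : Prop :=
  (∃ q, m ∈ incoming D q ∧ α ∈ incoming D q) ∧ α.getLast? = some c

/-- The letter `c` lies strictly between the last letters of `m` and `M`, where the empty string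
counts as ending with a symbol smaller than every letter. -/
def EndBetween (m M : List A) (c : A) : Prop :=
  (∀ a ∈ m.getLast?, a < c) ∧ ∃ b ∈ M.getLast?, c < b

/-- `τ'` is a possible output of `Expand(τ)`. A pair `(m, M)` whose components end with the same
letter is kept. Any other pair is replaced by `(m, m)`, `(M, M)` and, for each letter `c` strictly
between the last letters of `m` and `M` such that some string ending with `c` enters the state
reached by `m`, by one pair `(α_c, α_c)`, where `α_c = w (m, M) c` is any such string. -/
def IsExpand (D : NFA A σ) (τ τ' : Finset (List A × List A)) : Prop :=
  ∃ w : List A × List A → A → List A,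
    (∀ p ∈ τ, ∀ c, (∃ α, EndsAt D p.1 c α) → EndsAt D p.1 c (w p c)) ∧
    ∀ x, x ∈ τ' ↔ ∃ p ∈ τ,
      (p.1.getLast? = p.2.getLast? ∧ x = p) ∨
      (p.1.getLast? ≠ p.2.getLast? ∧
        (x = (p.1, p.1) ∨ x = (p.2, p.2) ∨
          ∃ c, EndBetween p.1 p.2 c ∧ (∃ α, EndsAt D p.1 c α) ∧ x = (w p c, w p c)))

/-- The condition of the while loop on two pairs `p = (m, M)` and `p' = (m', M')`:
`m ≺ m' ≺ M`. -/
def Overlap (p p' : List A × List A) : Prop := ColexLt p.1 p'.1 ∧ ColexLt p'.1 p.2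

/-- The configurations of a run of the algorithm: before the initialization, at the head of the
while loop with the current set of pairs, and after returning a set of strings. -/
inductive Config (A : Type*) where
  | start : Config A
  | loop (τ : Finset (List A × List A)) : Config A
  | done (F : Finset (List A)) : Config A

/-- The steps of the algorithm on input `D`. The choice of the overlapping pairs in an iteration
and of the strings in `Expand` is left free. -/
inductive Step (D : NFA A σ) : Config A → Config A → Prop where
  | init {τ} (h : IsMinMaxPairs D τ) : Step D .start (.loop τ)
  | iterate {τ} {m M m' M' M₁ m₂ : List A} (hp : (m, M) ∈ τ) (hp' : (m', M') ∈ τ)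
      (h : Overlap (m, M) (m', M')) (h₁ : IsGreatestSmaller D m m' M₁)
      (h₂ : IsSmallestGreater D m m' m₂) :
      Step D (.loop τ) (.loop (τ.erase (m, M) ∪ {(m, M₁), (m₂, M)}))
  | exit {τ τ'} (h : ∀ p ∈ τ, ∀ p' ∈ τ, ¬ Overlap p p') (hx : IsExpand D τ τ') :
      Step D (.loop τ) (.done (τ'.image Prod.fst))

/-- The configurations that occur in runs of the algorithm on input `D`. -/
def Reachable (D : NFA A σ) (c : Config A) : Prop := Relation.ReflTransGen (Step D) .start c

end Algorithm

section Construction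

variable {A : Type*} [LinearOrder A]

/-- `s` and `t` are consecutive elements of `F` in the co-lexicographic order. -/
def Consecutive (F : Finset (List A)) (s t : List A) : Prop :=
  s ∈ F ∧ t ∈ F ∧ ColexLt s t ∧ ∀ γ ∈ F, ¬ (ColexLt s γ ∧ ColexLt γ t)

/-- The element `β` of `F` that is selected for the string `x`, by locating `x` among the elements
of `F`: `x` is below all of `F`, above all of `F`, or between consecutive elements `s`, `t`; in the
last case Myhill-Nerode equivalence and, if needed, the last letter decide between `s` and `t`. -/
def Selects (L : Language A) (F : Finset (List A)) (x β : List A) : Prop :=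
  ((∀ γ ∈ F, ColexLe x γ) ∧ IsColexMin (F : Set (List A)) β) ∨
  ((∀ γ ∈ F, ColexLe γ x) ∧ IsColexMax (F : Set (List A)) β) ∨
  ∃ s t, Consecutive F s t ∧ ColexLe s x ∧ ColexLe x t ∧
    ((MNEquiv L s x ∧ ¬ MNEquiv L x t ∧ β = s) ∨
     (¬ MNEquiv L s x ∧ MNEquiv L x t ∧ β = t) ∨
     (MNEquiv L s x ∧ MNEquiv L x t ∧
       ((x.getLast? = s.getLast? ∧ β = s) ∨ (x.getLast? = t.getLast? ∧ β = t))))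

/-- The automaton built from a fingerprint `F` of `L`: its states are the elements of `F`, the
initial state is the smallest one, the final states are those in `L`, and `α` has a `c`-transition
exactly if `αc` is a prefix of a string of `L`, to the state selected for `αc`. -/
def fingerprintAutomaton (L : Language A) (F : Finset (List A)) : NFA A {α // α ∈ F} where
  step α c := {β | α.1 ++ [c] ∈ Pref L ∧ Selects L F (α.1 ++ [c]) β.1}
  start := {α | IsColexMin (F : Set (List A)) α.1}
  accept := {α | α.1 ∈ L}

end Construction

end Wheeler

namespace Wheeler

/-! ### The co-lexicographic order and its convex sets. -/

section Order

variable {A : Type*} [LinearOrder A]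

/-! The states of the minimum WDFA are the classes of `ConvEquiv L` on `Pref L`, so everything
reduces to showing that the algorithm picks one string from each class. Four facts carry this.

Path coherence: in a Wheeler NFA, if two strings reach the same set of states, so does every prefix
of `L` between them (`IsWheelerOrder.eval_eq_of_colexLt`). Hence all strings reaching one state of a
WDFA are `ConvEquiv`, which gives the lower bound on the number of states. Also, as there are
finitely many sets of states, two distinct Myhill-Nerode classes cannot alternate forever along a
monotone sequence.

Short representatives: every class contains a string of length at most `n ^ 2 + n`
(`IsReduced.exists_convEquiv_length_le`). Keep a suffix of length `n ^ 2` and shorten the rest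
within its Myhill-Nerode class. A foreign prefix between the two strings would share with them a
loop inside the suffix; pumping that loop would produce a forbidden infinite alternation.

Loop invariant: the intervals of the pairs cover the short strings of their states, and pairs of the
same Myhill-Nerode class are separated by a prefix outside it. Each split loses the string `m'`, so
the loop ends. When no pairs overlap, each interval lies in a single Myhill-Nerode class, and the
Wheeler classes correspond to an interval together with a last letter; `Expand` chooses one string
for each.

Construction: `ConvEquiv` is right-invariant and its classes are convex in `Pref L`, so comparing
`αc` with its neighbours in `F` finds the representative of its class (`selects_iff`). -/

theorem colexLt_iff {α β : List A} :
    ColexLt α β ↔ @LT.lt (List A) Preorder.toLT α.reverse β.reverse := Iff.rfl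

theorem colexLe_iff {α β : List A} : ColexLe α β ↔ α.reverse ≤ β.reverse := by
  rw [ColexLe, colexLt_iff, le_iff_lt_or_eq, List.reverse_inj]

theorem ColexLe.refl (α : List A) : ColexLe α α := Or.inr rfl

theorem ColexLt.le {α β : List A} (h : ColexLt α β) : ColexLe α β := Or.inl h

theorem ColexLe.trans {α β γ : List A} (h : ColexLe α β) (h' : ColexLe β γ) : ColexLe α γ := by
  rw [colexLe_iff] at *; exact h.trans h'

theorem ColexLt.trans {α β γ : List A} (h : ColexLt α β) (h' : ColexLt β γ) : ColexLt α γ := by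
  rw [colexLt_iff] at *; exact h.trans h'

theorem ColexLt.trans_le {α β γ : List A} (h : ColexLt α β) (h' : ColexLe β γ) : ColexLt α γ := by
  rw [colexLt_iff, colexLe_iff] at *; exact h.trans_le h'

theorem ColexLe.trans_lt {α β γ : List A} (h : ColexLe α β) (h' : ColexLt β γ) : ColexLt α γ := by
  rw [colexLt_iff, colexLe_iff] at *; exact h.trans_lt h'

theorem colexLt_irrefl (α : List A) : ¬ ColexLt α α := by
  rw [colexLt_iff]; exact lt_irrefl _

theorem ColexLt.not_le {α β : List A} (h : ColexLt α β) : ¬ ColexLe β α :=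
  fun h' => colexLt_irrefl _ (h.trans_le h')

theorem colexLe_or_lt (α β : List A) : ColexLe α β ∨ ColexLt β α := by
  rw [colexLt_iff, colexLe_iff]; exact le_or_gt _ _

theorem colexLe_total (α β : List A) : ColexLe α β ∨ ColexLe β α :=
  (colexLe_or_lt α β).imp_right ColexLt.le

theorem ColexLe.antisymm {α β : List A} (h : ColexLe α β) (h' : ColexLe β α) : α = β := by
  rcases h with h | h
  · exact absurd h' h.not_le
  · exact h

theorem ColexLe.lt_of_ne {α β : List A} (h : ColexLe α β) (h' : α ≠ β) : ColexLt α β :=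
  h.resolve_right h'

theorem nil_colexLe (α : List A) : ColexLe [] α := by
  rw [colexLe_iff]
  cases h : α.reverse with
  | nil => exact le_rfl
  | cons a l => exact (List.nil_lt_cons a l : @LT.lt (List A) Preorder.toLT _ _).le

theorem nil_colexLt {α : List A} (h : α ≠ []) : ColexLt [] α :=
  (nil_colexLe α).lt_of_ne h.symm

theorem concat_colexLt_concat_iff {α β : List A} {a b : A} :
    ColexLt (α ++ [a]) (β ++ [b]) ↔ a < b ∨ a = b ∧ ColexLt α β := by
  simp only [ColexLt, List.reverse_append, List.reverse_cons, List.reverse_nil, List.nil_append,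
    List.cons_append, List.cons_lt_cons_iff]

theorem append_colexLt_append_iff {α β : List A} (γ : List A) :
    ColexLt (α ++ γ) (β ++ γ) ↔ ColexLt α β := by
  induction γ using List.reverseRecOn with
  | nil => simp
  | append_singleton γ c ih =>
    rw [← List.append_assoc, ← List.append_assoc, concat_colexLt_concat_iff, ih]
    simp

theorem append_colexLe_append_iff {α β : List A} (γ : List A) :
    ColexLe (α ++ γ) (β ++ γ) ↔ ColexLe α β := by
  simp only [ColexLe, append_colexLt_append_iff, List.append_left_inj]

/-- `γ` lies weakly between `α` and `β`, in either order. -/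
def Between (α γ β : List A) : Prop := ColexLe α γ ∧ ColexLe γ β ∨ ColexLe β γ ∧ ColexLe γ α

theorem Between.symm {α γ β : List A} (h : Between α γ β) : Between β γ α := Or.symm h

theorem Between.split {α γ δ : List A} (h : Between α δ γ) (β : List A) :
    Between α δ β ∨ Between β δ γ := by
  rcases h with ⟨h, h'⟩ | ⟨h, h'⟩ <;> rcases colexLe_total β δ with h₁ | h₁
  · exact Or.inr (Or.inl ⟨h₁, h'⟩)
  · exact Or.inl (Or.inl ⟨h, h₁⟩)
  · exact Or.inl (Or.inr ⟨h₁, h'⟩)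
  · exact Or.inr (Or.inr ⟨h, h₁⟩)

/-- Comparison starts at the right end, so the strings with a given suffix form an interval. -/
theorem exists_append_of_colexLe {α β γ : List A} (v : List A) (h : ColexLe (α ++ v) γ)
    (h' : ColexLe γ (β ++ v)) : ∃ δ, γ = δ ++ v := by
  induction v using List.reverseRecOn generalizing γ with
  | nil => exact ⟨γ, by simp⟩
  | append_singleton v c ih =>
    rw [← List.append_assoc] at h h'
    rcases List.eq_nil_or_concat' γ with rfl | ⟨γ, d, rfl⟩
    · have := h.antisymm (nil_colexLe _)
      simp at this
    · have hdc : d = c := by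
        apply le_antisymm
        · rcases h' with h' | h'
          · rw [concat_colexLt_concat_iff] at h'; rcases h' with h' | h'
            · exact h'.le
            · exact h'.1.le
          · exact (List.singleton_inj.1 (List.append_inj' h' rfl).2).le
        · rcases h with h | h
          · rw [concat_colexLt_concat_iff] at h; rcases h with h | h
            · exact h.le
            · exact h.1.le
          · exact (List.singleton_inj.1 (List.append_inj' h rfl).2).le
      subst hdc
      rw [append_colexLe_append_iff] at h h'
      obtain ⟨δ, rfl⟩ := ih h h'
      exact ⟨δ, by simp⟩

theorem Between.exists_append {α β γ v : List A} (h : Between (α ++ v) γ (β ++ v)) :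
    ∃ δ, γ = δ ++ v ∧ Between α δ β := by
  have : ∃ δ, γ = δ ++ v := by
    rcases h with h | h
    · exact exists_append_of_colexLe v h.1 h.2
    · exact exists_append_of_colexLe v h.1 h.2
  obtain ⟨δ, rfl⟩ := this
  exact ⟨δ, rfl, by simpa only [Between, append_colexLe_append_iff] using h⟩

theorem Between.getLast?_eq {α β γ : List A} (h : Between α γ β)
    (he : α.getLast? = β.getLast?) : γ.getLast? = α.getLast? := by
  cases hβ : β.getLast? with
  | none =>
    rw [hβ] at he
    rw [List.getLast?_eq_none_iff] at he hβ
    subst he hβ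
    rcases h with h | h <;> rw [h.2.antisymm h.1]
  | some c =>
    rw [hβ] at he
    obtain ⟨α, rfl⟩ := List.getLast?_eq_some_iff.1 he
    obtain ⟨β, rfl⟩ := List.getLast?_eq_some_iff.1 hβ
    obtain ⟨δ, rfl, -⟩ := h.exists_append
    simp

theorem exists_isColexMin {S : Set (List A)} (hS : S.Finite) (hne : S.Nonempty) :
    ∃ x, IsColexMin S x := by
  obtain ⟨x, hx, h⟩ := Set.exists_min_image S List.reverse hS hne
  exact ⟨x, hx, fun y hy => colexLe_iff.2 (h y hy)⟩

theorem exists_isColexMax {S : Set (List A)} (hS : S.Finite) (hne : S.Nonempty) :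
    ∃ x, IsColexMax S x := by
  obtain ⟨x, hx, h⟩ := Set.exists_max_image S List.reverse hS hne
  exact ⟨x, hx, fun y hy => colexLe_iff.2 (h y hy)⟩

end Order

/-! ### Myhill-Nerode classes, Wheeler classes and fingerprints. -/

section Classes

variable {A : Type*} {L : Language A}

theorem mnEquiv_iff {α β : List A} : MNEquiv L α β ↔ ∀ γ, α ++ γ ∈ L ↔ β ++ γ ∈ L :=
  ⟨fun h γ => by
    have := congrArg (fun M : Language A => γ ∈ M) h
    simpa using this, fun h => Set.ext h⟩

theorem MNEquiv.refl (α : List A) : MNEquiv L α α := rfl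

theorem MNEquiv.symm {α β : List A} (h : MNEquiv L α β) : MNEquiv L β α := Eq.symm h

theorem MNEquiv.trans {α β γ : List A} (h : MNEquiv L α β) (h' : MNEquiv L β γ) :
    MNEquiv L α γ := Eq.trans h h'

theorem MNEquiv.append {α β : List A} (h : MNEquiv L α β) (γ : List A) :
    MNEquiv L (α ++ γ) (β ++ γ) := by
  rw [mnEquiv_iff] at *
  intro δ
  simpa using h (γ ++ δ)

theorem MNEquiv.mem_pref_iff {α β : List A} (h : MNEquiv L α β) : α ∈ Pref L ↔ β ∈ Pref L := by
  rw [mnEquiv_iff] at h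
  exact exists_congr h

theorem MNEquiv.mem_iff {α β : List A} (h : MNEquiv L α β) : α ∈ L ↔ β ∈ L := by
  simpa using mnEquiv_iff.1 h []

theorem mem_pref_of_append {α β : List A} (h : α ++ β ∈ Pref L) : α ∈ Pref L := by
  obtain ⟨γ, h⟩ := h
  exact ⟨β ++ γ, by simpa using h⟩

variable [LinearOrder A]

theorem convEquiv_iff {α β : List A} : ConvEquiv L α β ↔
    MNEquiv L α β ∧ α.getLast? = β.getLast? ∧
      ∀ γ ∈ Pref L, Between α γ β → MNEquiv L γ α := by
  constructor
  · exact fun h => ⟨h.1, h.2.1, fun γ hγ hb => (h.2.2 γ hγ hb).1.symm⟩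
  · exact fun h => ⟨h.1, h.2.1, fun γ hγ hb =>
      ⟨(h.2.2 γ hγ hb).symm, (h.2.2 γ hγ hb).trans h.1⟩⟩

theorem ConvEquiv.refl (α : List A) : ConvEquiv L α α := by
  refine convEquiv_iff.2 ⟨rfl, rfl, fun γ _ h => ?_⟩
  rcases h with h | h <;> rw [h.2.antisymm h.1] <;> exact MNEquiv.refl _

theorem ConvEquiv.symm {α β : List A} (h : ConvEquiv L α β) : ConvEquiv L β α := by
  rw [convEquiv_iff] at *
  exact ⟨h.1.symm, h.2.1.symm, fun γ hγ hb => (h.2.2 γ hγ hb.symm).trans h.1⟩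

theorem ConvEquiv.trans {α β γ : List A} (h : ConvEquiv L α β) (h' : ConvEquiv L β γ) :
    ConvEquiv L α γ := by
  rw [convEquiv_iff] at *
  refine ⟨h.1.trans h'.1, h.2.1.trans h'.2.1, fun δ hδ hb => ?_⟩
  rcases hb.split β with hb | hb
  · exact h.2.2 δ hδ hb
  · exact (h'.2.2 δ hδ hb).trans h.1.symm

theorem ConvEquiv.mem_pref_iff {α β : List A} (h : ConvEquiv L α β) :
    α ∈ Pref L ↔ β ∈ Pref L := h.1.mem_pref_iff

/-- Convexity of Wheeler classes within `Pref L`, the tool by which later arguments place a string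
in a class by comparison alone. -/
theorem ConvEquiv.of_between {α β γ : List A} (h : ConvEquiv L α β) (hγ : γ ∈ Pref L)
    (hb : Between α γ β) : ConvEquiv L α γ := by
  rw [convEquiv_iff] at *
  refine ⟨(h.2.2 γ hγ hb).symm, (hb.getLast?_eq h.2.1).symm, fun δ hδ hb' => h.2.2 δ hδ ?_⟩
  rcases hb with ⟨h₁, h₂⟩ | ⟨h₁, h₂⟩ <;> rcases hb' with ⟨h₃, h₄⟩ | ⟨h₃, h₄⟩
  · exact Or.inl ⟨h₃, h₄.trans h₂⟩
  · exact Or.inl ⟨h₁.trans h₃, h₄.trans (h₁.trans h₂)⟩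
  · exact Or.inr ⟨(h₁.trans h₂).trans h₃, h₄.trans h₂⟩
  · exact Or.inr ⟨h₁.trans h₃, h₄⟩

/-- Anything between `αc` and `βc` ends with `c`, and deleting that letter leaves a string between
`α` and `β`. -/
theorem ConvEquiv.append_singleton {α β : List A} (h : ConvEquiv L α β) (c : A) :
    ConvEquiv L (α ++ [c]) (β ++ [c]) := by
  rw [convEquiv_iff] at *
  refine ⟨h.1.append _, by simp, fun γ hγ hb => ?_⟩
  obtain ⟨δ, rfl, hb'⟩ := hb.exists_append
  exact (h.2.2 δ (mem_pref_of_append hγ) hb').append _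

/-- Distinct Wheeler classes are ordered like any of their members. -/
theorem ConvEquiv.colexLe {α β α' β' : List A} (hα : ConvEquiv L α α') (hβ : ConvEquiv L β β')
    (hα' : α ∈ Pref L) (hβ' : β ∈ Pref L) (h : ColexLe α β) :
    ColexLt α' β' ∨ ConvEquiv L α' β' := by
  rcases colexLe_or_lt β' α' with h' | h'
  · right
    rcases colexLe_or_lt β α' with h₁ | h₁
    · exact hα.symm.trans ((hα.of_between hβ' (Or.inl ⟨h, h₁⟩)).trans hβ)
    · exact (hβ.of_between (hα.mem_pref_iff.1 hα') (Or.inr ⟨h', h₁.le⟩)).symm.trans hβ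
  · exact Or.inl h'

theorem isFingerprint_iff {F : Finset (List A)} : IsFingerprint L F ↔
    (∀ α ∈ F, α ∈ Pref L) ∧ ∀ α ∈ Pref L, ∃! β, β ∈ F ∧ ConvEquiv L α β := by
  have key : ∀ α ∈ Pref L, (((F : Set (List A)) ∩ {β | β ∈ Pref L ∧ ConvEquiv L α β}).ncard = 1 ↔
      ∃! β, β ∈ F ∧ ConvEquiv L α β) := by
    intro α hα
    rw [Set.ncard_eq_one]
    constructor
    · rintro ⟨β, hβ⟩
      have h : ∀ x, x ∈ F ∧ ConvEquiv L α x ↔ x = β := fun x => by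
        rw [← Set.mem_singleton_iff, ← hβ]
        exact ⟨fun h => ⟨h.1, h.2.mem_pref_iff.1 hα, h.2⟩, fun h => ⟨h.1, h.2.2⟩⟩
      exact ⟨β, (h β).2 rfl, fun x hx => (h x).1 hx⟩
    · rintro ⟨β, hβ, hu⟩
      refine ⟨β, Set.ext fun x => ⟨fun h => hu x ⟨h.1, h.2.2⟩, ?_⟩⟩
      rintro rfl
      exact ⟨hβ.1, hβ.2.mem_pref_iff.1 hα, hβ.2⟩
  constructor
  · rintro ⟨h₁, h₂⟩
    refine ⟨fun α hα => ?_, fun α hα => (key α hα).1 (h₂ _ ⟨α, hα, rfl⟩)⟩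
    obtain ⟨C, ⟨β, _, rfl⟩, h⟩ := h₁ α hα
    exact h.1
  · rintro ⟨h₁, h₂⟩
    refine ⟨fun α hα => ⟨_, ⟨α, h₁ α hα, rfl⟩, h₁ α hα, ConvEquiv.refl α⟩, ?_⟩
    rintro C ⟨α, hα, rfl⟩
    exact (key α hα).2 (h₂ α hα)

end Classes

/-! ### Path coherence of Wheeler automata. -/

section Coherence

variable {A : Type*} {σ : Type*} {M : NFA A σ}

theorem mem_eval_append_singleton {α : List A} {a : A} {v : σ} :
    v ∈ M.eval (α ++ [a]) ↔ ∃ u ∈ M.eval α, v ∈ M.step u a := by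
  rw [NFA.eval_append_singleton, NFA.mem_stepSet]

theorem append_mem_accepts_iff {α γ : List A} :
    α ++ γ ∈ M.accepts ↔ ∃ f ∈ M.accept, f ∈ M.evalFrom (M.eval α) γ := by
  rw [NFA.mem_accepts, NFA.evalFrom_append]; rfl

theorem mnEquiv_of_eval_eq {α β : List A} (h : M.eval α = M.eval β) :
    MNEquiv M.accepts α β :=
  mnEquiv_iff.2 fun γ => by rw [append_mem_accepts_iff, append_mem_accepts_iff, h]

theorem eval_nonempty_of_mem_pref {α : List A} (h : α ∈ Pref M.accepts) :
    (M.eval α).Nonempty := by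
  obtain ⟨γ, hγ⟩ := h
  obtain ⟨f, -, hf⟩ := append_mem_accepts_iff.1 hγ
  obtain ⟨t, ht, -⟩ := NFA.mem_evalFrom_iff_exists.1 hf
  exact ⟨t, ht⟩

theorem mem_pref_iff_eval_nonempty (hM : IsTrimmedAutomaton M) {α : List A} :
    α ∈ Pref M.accepts ↔ (M.eval α).Nonempty := by
  refine ⟨eval_nonempty_of_mem_pref, ?_⟩
  rintro ⟨q, hq⟩
  obtain ⟨γ, f, hf, hγ⟩ := hM.2.2 q
  exact ⟨γ, append_mem_accepts_iff.2 ⟨f, hf, NFA.mem_evalFrom_iff_exists.2 ⟨q, hq, hγ⟩⟩⟩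

theorem IsDFA.eval_subsingleton (hM : IsDFA M) (α : List A) : (M.eval α).Subsingleton := by
  induction α using List.reverseRecOn with
  | nil =>
    obtain ⟨q, hq⟩ := hM.1.1
    rw [NFA.eval_nil, hq]
    exact Set.subsingleton_singleton
  | append_singleton α a ih =>
    intro u hu v hv
    obtain ⟨u', hu', hu⟩ := mem_eval_append_singleton.1 hu
    obtain ⟨v', hv', hv⟩ := mem_eval_append_singleton.1 hv
    obtain rfl := ih hu' hv'
    exact hM.2 _ _ hu hv

theorem IsDFA.eval_eq (hM : IsDFA M) {α : List A} {q : σ} (h : q ∈ M.eval α) :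
    M.eval α = {q} :=
  (hM.eval_subsingleton α).eq_singleton_of_mem h

theorem IsDFA.mnEquiv (hM : IsDFA M) {α β : List A} {q : σ} (hα : q ∈ M.eval α)
    (hβ : q ∈ M.eval β) : MNEquiv M.accepts α β :=
  mnEquiv_of_eval_eq ((hM.eval_eq hα).trans (hM.eval_eq hβ).symm)

variable [LinearOrder A] {lt : σ → σ → Prop}

/-- Path coherence: the sets of states reached by two strings are ordered like the strings,
except for the states reached by both. -/
theorem IsWheelerOrder.lt_or_eq_of_colexLt (hM : IsWheelerOrder M lt) {α β : List A} (h : ColexLt α β) {u v : σ}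
    (hu : u ∈ M.eval α) (hv : v ∈ M.eval β) (huv : ¬ (u ∈ M.eval β ∧ v ∈ M.eval α)) :
    lt u v ∨ u = v := by
  induction α using List.reverseRecOn generalizing β u v with
  | nil =>
    by_cases huv' : u = v
    · exact Or.inr huv'
    · exact Or.inl ((hM.2.1 u hu).1 v (Ne.symm huv'))
  | append_singleton α a ih =>
    rcases List.eq_nil_or_concat' β with rfl | ⟨β, b, rfl⟩
    · exact absurd (nil_colexLe _) h.not_le
    obtain ⟨u', hu', hu⟩ := mem_eval_append_singleton.1 hu
    obtain ⟨v', hv', hv⟩ := mem_eval_append_singleton.1 hv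
    have hstep := hM.2.2 _ _ _ _ _ _ hu hv
    rcases concat_colexLt_concat_iff.1 h with hab | ⟨rfl, hαβ⟩
    · exact Or.inl (hstep.1 hab)
    -- If both strings reached both predecessors, both would reach `u` and `v`. This also excludes
    -- `u' = v'`.
    · have key : ¬ (u' ∈ M.eval β ∧ v' ∈ M.eval α) := fun hk => huv
        ⟨mem_eval_append_singleton.2 ⟨u', hk.1, hu⟩, mem_eval_append_singleton.2 ⟨v', hk.2, hv⟩⟩
      rcases ih hαβ hu' hv' key with h' | rfl
      · exact hstep.2 ⟨rfl, h'⟩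
      · exact absurd ⟨hv', hu'⟩ key

/-- A state in just one of the two sets, compared with any state of the other set, would be both
below and above it: once because `α ≺ β`, once because `β ≺ γ`. -/
theorem IsWheelerOrder.eval_eq_of_colexLt (hM : IsWheelerOrder M lt) {α β γ : List A} (h : ColexLt α β) (h' : ColexLt β γ)
    (hαγ : M.eval α = M.eval γ) (hα : (M.eval α).Nonempty) (hβ : (M.eval β).Nonempty) :
    M.eval β = M.eval α := by
  have := hM.1
  obtain ⟨s, hs'⟩ := hα
  have sub : M.eval β ⊆ M.eval α := by
    intro t ht
    by_contra hn
    have h₁ := hM.lt_or_eq_of_colexLt h hs' ht (fun hk => hn hk.2)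
    rw [hαγ] at hs' hn
    have h₂ := hM.lt_or_eq_of_colexLt h' ht hs' (fun hk => hn hk.1)
    have hne : s ≠ t := fun e => hn (e ▸ hs')
    exact irrefl_of lt s
      (trans_of lt (h₁.resolve_right hne) (h₂.resolve_right (Ne.symm hne)))
  refine sub.antisymm fun s hs' => ?_
  by_contra hn
  obtain ⟨t, ht⟩ := hβ
  have hne : s ≠ t := fun e => hn (e ▸ ht)
  have h₁ := hM.lt_or_eq_of_colexLt h hs' ht (fun hk => hn hk.1)
  rw [hαγ] at hs'
  have h₂ := hM.lt_or_eq_of_colexLt h' ht hs' (fun hk => hn hk.2)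
  exact irrefl_of lt s (trans_of lt (h₁.resolve_right hne) (h₂.resolve_right (Ne.symm hne)))

/-- States of a Wheeler automaton are input consistent. -/
theorem IsWheelerOrder.getLast?_eq (hM : IsWheelerOrder M lt) {α β : List A} {q : σ}
    (hα : q ∈ M.eval α) (hβ : q ∈ M.eval β) : α.getLast? = β.getLast? := by
  have := hM.1
  rcases List.eq_nil_or_concat' α with rfl | ⟨α, a, rfl⟩ <;>
    rcases List.eq_nil_or_concat' β with rfl | ⟨β, b, rfl⟩
  · rfl
  · obtain ⟨u, -, hu⟩ := mem_eval_append_singleton.1 hβ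
    exact absurd hu ((hM.2.1 q hα).2 u b)
  · obtain ⟨u, -, hu⟩ := mem_eval_append_singleton.1 hα
    exact absurd hu ((hM.2.1 q hβ).2 u a)
  · obtain ⟨u, -, hu⟩ := mem_eval_append_singleton.1 hα
    obtain ⟨v, -, hv⟩ := mem_eval_append_singleton.1 hβ
    rcases lt_trichotomy a b with h | rfl | h
    · exact absurd ((hM.2.2 _ _ _ _ _ _ hu hv).1 h) (irrefl_of lt q)
    · simp
    · exact absurd ((hM.2.2 _ _ _ _ _ _ hv hu).1 h) (irrefl_of lt q)

/-- The strings reaching a state of a Wheeler DFA lie in one Wheeler class. -/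
theorem IsWheelerOrder.convEquiv (hM : IsWheelerOrder M lt) (hD : IsDFA M) {α β : List A} {q : σ}
    (hα : q ∈ M.eval α) (hβ : q ∈ M.eval β) : ConvEquiv M.accepts α β := by
  have main : ∀ {α β γ : List A}, q ∈ M.eval α → q ∈ M.eval β → γ ∈ Pref M.accepts →
      ColexLe α γ → ColexLe γ β → MNEquiv M.accepts γ α := by
    intro α β γ hα hβ hγ h₁ h₂
    rcases h₁ with h₁ | rfl
    · rcases h₂ with h₂ | rfl
      · exact mnEquiv_of_eval_eq (hM.eval_eq_of_colexLt h₁ h₂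
          ((hD.eval_eq hα).trans (hD.eval_eq hβ).symm) ⟨q, hα⟩ (eval_nonempty_of_mem_pref hγ))
      · exact hD.mnEquiv hβ hα
    · exact MNEquiv.refl _
  refine convEquiv_iff.2 ⟨hD.mnEquiv hα hβ, hM.getLast?_eq hα hβ, fun γ hγ hb => ?_⟩
  rcases hb with h | h
  · exact main hα hβ hγ h.1 h.2
  · exact (main hβ hα hγ h.1 h.2).trans (hD.mnEquiv hβ hα)

/-- By pigeonhole two of the `X i` reach the same set of states, and so does the `Y` caught between
them. -/
theorem IsWheelerLanguage.exists_mnEquiv {L : Language A} (hL : IsWheelerLanguage L)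
    (X Y : ℕ → List A) (hX : ∀ i, X i ∈ Pref L) (hY : ∀ i, Y i ∈ Pref L)
    (h : ∀ i j, i < j → ColexLt (X i) (Y i) ∧ ColexLt (Y i) (X j) ∨
      ColexLt (X j) (Y i) ∧ ColexLt (Y i) (X i)) :
    ∃ i, MNEquiv L (X i) (Y i) := by
  obtain ⟨ρ, _, N, ⟨-, lt, hlt⟩, rfl⟩ := hL
  obtain ⟨i, j, hij, he⟩ := Finite.exists_ne_map_eq_of_infinite fun i => N.eval (X i)
  have key : ∀ i j, i < j → N.eval (X i) = N.eval (X j) → N.eval (Y i) = N.eval (X i) := by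
    intro i j hij he
    rcases h i j hij with h | h
    · exact hlt.eval_eq_of_colexLt h.1 h.2 he (eval_nonempty_of_mem_pref (hX i))
        (eval_nonempty_of_mem_pref (hY i))
    · exact (hlt.eval_eq_of_colexLt h.1 h.2 he.symm (eval_nonempty_of_mem_pref (hX j))
        (eval_nonempty_of_mem_pref (hY i))).trans he.symm
  rcases lt_or_gt_of_ne hij with hij | hij
  · exact ⟨i, mnEquiv_of_eval_eq (key i j hij he).symm⟩
  · exact ⟨j, mnEquiv_of_eval_eq (key j i hij he.symm).symm⟩

end Coherence

/-! ### Pumping loops in a Wheeler language. -/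

section Pumping

variable {A : Type*} [LinearOrder A] {L : Language A}

omit [LinearOrder A] in
theorem MNEquiv.iterate {x g : List A} (h : MNEquiv L x (x ++ g)) (k : ℕ) :
    MNEquiv L x ((· ++ g)^[k] x) := by
  induction k with
  | zero => exact MNEquiv.refl _
  | succ k ih =>
    rw [Function.iterate_succ_apply']
    exact h.trans (ih.append g)

omit [LinearOrder A] in
theorem iterate_append (x g : List A) (k : ℕ) :
    (· ++ g)^[k] x = x ++ (· ++ g)^[k] [] := by
  induction k with
  | zero => simp
  | succ k ih => rw [Function.iterate_succ_apply', Function.iterate_succ_apply', ih]; simp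

omit [LinearOrder A] in
theorem le_length_iterate {g : List A} (hg : g ≠ []) (k : ℕ) :
    k ≤ ((· ++ g)^[k] []).length := by
  induction k with
  | zero => simp
  | succ k ih =>
    rw [Function.iterate_succ_apply']
    have := List.length_pos_iff.2 hg
    simp only [List.length_append]
    omega

/-- A string shorter than `g` cannot end with `g`, so it lies on one side of the whole interval of
strings with suffix `g`. -/
theorem colexLt_append_or {y g : List A} (h : y.length < g.length) (x z : List A) :
    ColexLt y (x ++ g) ∨ ColexLt (z ++ g) y := by
  induction g using List.reverseRecOn generalizing y with
  | nil => simp at h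
  | append_singleton g c ih =>
    rw [← List.append_assoc, ← List.append_assoc]
    rcases List.eq_nil_or_concat' y with rfl | ⟨y, d, rfl⟩
    · exact Or.inl (nil_colexLt (by simp))
    · rw [concat_colexLt_concat_iff, concat_colexLt_concat_iff]
      rcases lt_trichotomy c d with h' | rfl | h'
      · exact Or.inr (Or.inl h')
      · exact (ih (by simpa using h)).imp (fun h => Or.inr ⟨rfl, h⟩) fun h => Or.inr ⟨rfl, h⟩
      · exact Or.inl (Or.inl h')

/-- The relation is left abstract so as to serve for the order and for its reverse. -/
theorem alternating_iterate {T : Type*} {r : T → T → Prop} (htr : ∀ a b c, r a b → r b c → r a c)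
    {f : T → T} (hf : ∀ a b, r a b → r (f a) (f b)) {x y : T} (h : r x y) (h' : r y (f x))
    {i j : ℕ} (hij : i < j) : r (f^[i] x) (f^[i] y) ∧ r (f^[i] y) (f^[j] x) := by
  have hf' : ∀ i a b, r a b → r (f^[i] a) (f^[i] b) := by
    intro i
    induction i with
    | zero => exact fun _ _ h => h
    | succ i ih => exact fun a b h => ih _ _ (hf a b h)
  refine ⟨hf' i _ _ h, ?_⟩
  induction j, hij using Nat.le_induction with
  | base => exact hf' i _ _ h'
  | succ j _ ih => exact htr _ _ _ ih (hf' j _ _ (htr _ _ _ h h'))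

/-- In a Wheeler language, two distinct Myhill-Nerode classes that admit a common loop label are
not interleaved. -/
theorem IsWheelerLanguage.mnEquiv_of_loop (hL : IsWheelerLanguage L) {x y z g : List A}
    (hg : g ≠ []) (hx : MNEquiv L x (x ++ g)) (hy : MNEquiv L y (y ++ g)) (hz : MNEquiv L x z)
    (hxP : x ∈ Pref L) (hyP : y ∈ Pref L) (h₁ : ColexLe x y) (h₂ : ColexLe y z) :
    MNEquiv L x y := by
  rcases h₁ with h₁ | rfl
  swap
  · exact MNEquiv.refl _
  rcases h₂ with h₂ | rfl
  swap
  · exact hz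
  -- A power of `g` longer than `y`; it is again a loop label for both classes.
  set G := (· ++ g)^[y.length + 1] [] with hG
  have hGy : y.length < G.length := le_length_iterate hg _
  have hiter : ∀ {w}, MNEquiv L w (w ++ g) → ∀ k, MNEquiv L w ((· ++ G)^[k] w) := by
    intro w hw k
    refine MNEquiv.iterate ?_ k
    rw [hG, ← iterate_append]
    exact hw.iterate _
  -- Take `w = x` if `y ≺ xG`, where the alternation increases, and `w = z` if `zG ≺ y`, where it
  -- decreases.
  have main : ∀ w, MNEquiv L x w → (∀ i j, i < j →
      ColexLt ((· ++ G)^[i] w) ((· ++ G)^[i] y) ∧ ColexLt ((· ++ G)^[i] y) ((· ++ G)^[j] w) ∨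
      ColexLt ((· ++ G)^[j] w) ((· ++ G)^[i] y) ∧ ColexLt ((· ++ G)^[i] y) ((· ++ G)^[i] w)) →
      MNEquiv L x y := by
    intro w hxw h
    have hw : MNEquiv L w (w ++ g) := hxw.symm.trans (hx.trans (hxw.append g))
    obtain ⟨i, hi⟩ := hL.exists_mnEquiv _ _
      (fun i => ((hxw.trans (hiter hw i)).mem_pref_iff).1 hxP)
      (fun i => (hiter hy i).mem_pref_iff.1 hyP) h
    exact hxw.trans ((hiter hw i).trans (hi.trans (hiter hy i).symm))
  rcases colexLt_append_or hGy x z with h | h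
  · exact main x (MNEquiv.refl _) fun i j hij => Or.inl
      (alternating_iterate (r := ColexLt) (fun _ _ _ => ColexLt.trans)
        (fun _ _ => (append_colexLt_append_iff G).2) h₁ h hij)
  · exact main z hz fun i j hij => Or.inr
      (alternating_iterate (r := fun a b => ColexLt b a) (fun _ _ _ h h' => h'.trans h)
        (fun _ _ => (append_colexLt_append_iff G).2) h₂ h hij).symm

omit [LinearOrder A] in
theorem exists_loop {T : Type*} [Fintype T] (f : List A → T) {v : List A}
    (hv : Fintype.card T ≤ v.length) :
    ∃ v₁ g v₂, v = v₁ ++ g ++ v₂ ∧ g ≠ [] ∧ f v₁ = f (v₁ ++ g) := by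
  obtain ⟨i, j, hij, he⟩ := Fintype.exists_ne_map_eq_of_card_lt
    (fun i : Fin (v.length + 1) => f (v.take i)) (by simpa [Nat.lt_succ_iff] using hv)
  have key : ∀ i j : Fin (v.length + 1), i < j → f (v.take i) = f (v.take j) →
      ∃ v₁ g v₂, v = v₁ ++ g ++ v₂ ∧ g ≠ [] ∧ f v₁ = f (v₁ ++ g) := by
    intro i j hij he
    have hcat : v.take i ++ (v.take j).drop i = v.take j := by
      conv_rhs => rw [← List.take_append_drop i (v.take j), List.take_take]
      rw [min_eq_left (show (i : ℕ) ≤ j from hij.le)]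
    refine ⟨v.take i, (v.take j).drop i, v.drop j, ?_, ?_, ?_⟩
    · rw [hcat, List.take_append_drop]
    · apply List.ne_nil_of_length_pos
      have : (i : ℕ) < j := hij
      have := j.2
      simp only [List.length_drop, List.length_take]
      omega
    · rw [hcat, he]
  rcases lt_or_gt_of_ne hij with hij | hij
  · exact key i j hij he
  · exact key j i hij he.symm

end Pumping

/-! ### The minimum DFA and short representatives. -/

section Reduced

variable {A : Type*} {σ : Type*} {L : Language A} {D : NFA A σ}

/-- The states of `D` are the Myhill-Nerode classes of the prefixes of `L`. -/
structure IsReduced (L : Language A) (D : NFA A σ) : Prop where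
  mem_pref_iff : ∀ {α}, α ∈ Pref L ↔ ∃ q, α ∈ incoming D q
  eq_iff : ∀ {α β q q'}, α ∈ incoming D q → β ∈ incoming D q' → (q = q' ↔ MNEquiv L α β)
  exists_mem : ∀ q, ∃ α, α ∈ incoming D q

theorem IsReduced.exists_state (hD : IsReduced L D) (hne : (Pref L).Nonempty) :
    ∃ f : List A → σ, ∀ α ∈ Pref L, ∀ β ∈ Pref L, f α = f β → MNEquiv L α β := by
  obtain ⟨α, hα⟩ := hne
  have : Nonempty σ := ⟨(hD.mem_pref_iff.1 hα).choose⟩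
  have h : ∀ α ∈ Pref L, ∃ q, α ∈ incoming D q := fun α hα => hD.mem_pref_iff.1 hα
  choose! f hf using h
  exact ⟨f, fun α hα β hβ h => (hD.eq_iff (hf α hα) (hf β hβ)).1 h⟩

theorem IsReduced.exists_mnEquiv_length_le [Fintype σ] (hD : IsReduced L D) {α : List A} (hα : α ∈ Pref L) :
    ∃ β, MNEquiv L α β ∧ β.length ≤ Fintype.card σ := by
  obtain ⟨f, hf⟩ := hD.exists_state ⟨α, hα⟩
  induction hk : α.length using Nat.strong_induction_on generalizing α with
  | _ k ih =>
    rcases Nat.lt_or_ge (Fintype.card σ) α.length with h | h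
    swap
    · exact ⟨α, MNEquiv.refl _, h⟩
    obtain ⟨v₁, g, v₂, rfl, hg, he⟩ := exists_loop f h.le
    have h₁ : v₁ ++ g ∈ Pref L := mem_pref_of_append hα
    have heq := ((hf _ (mem_pref_of_append h₁) _ h₁ he).append v₂).symm
    have := List.length_pos_iff.2 hg
    obtain ⟨β, hβ, hl⟩ := ih (v₁ ++ v₂).length
      (by simp only [List.length_append] at *; omega) (heq.mem_pref_iff.1 hα) rfl
    exact ⟨β, heq.trans hβ, hl⟩

/-- Every Wheeler class contains a short string. -/
theorem IsReduced.exists_convEquiv_length_le [Fintype σ] [LinearOrder A] (hD : IsReduced L D)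
    (hL : IsWheelerLanguage L) {α : List A} (hα : α ∈ Pref L) :
    ∃ β, ConvEquiv L α β ∧ β.length ≤ Fintype.card σ ^ 2 + Fintype.card σ := by
  obtain ⟨f, hf⟩ := hD.exists_state ⟨α, hα⟩
  set n := Fintype.card σ with hn
  have hn0 : 0 < n := Fintype.card_pos_iff.2 ⟨f α⟩
  rcases Nat.lt_or_ge (n ^ 2 + n) α.length with hlen | hlen
  swap
  · exact ⟨α, ConvEquiv.refl _, hlen⟩
  -- The suffix is as long as the number of pairs of states, so that two parallel runs on it must
  -- repeat a pair.
  obtain ⟨w, v, rfl, hv⟩ : ∃ w v, α = w ++ v ∧ v.length = n ^ 2 :=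
    ⟨α.take (α.length - n ^ 2), α.drop (α.length - n ^ 2), by simp, by
      rw [List.length_drop]; omega⟩
  have hw := mem_pref_of_append hα
  obtain ⟨u, hu, hul⟩ := hD.exists_mnEquiv_length_le hw
  refine ⟨u ++ v, convEquiv_iff.2 ⟨hu.append v, ?_, fun γ hγ hb => ?_⟩, ?_⟩
  · have : v ≠ [] := List.ne_nil_of_length_pos (by rw [hv]; positivity)
    rw [List.getLast?_append_of_ne_nil _ this, List.getLast?_append_of_ne_nil _ this]
  · obtain ⟨z, rfl, hb'⟩ := hb.exists_append
    -- `g` labels a loop on the runs from `w` and from `z` at once, as `mnEquiv_of_loop` requires.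
    obtain ⟨v₁, g, v₂, rfl, hg, he⟩ := exists_loop (fun x => (f (w ++ x), f (z ++ x))) (v := v)
      (by rw [Fintype.card_prod, hv, sq])
    have hpre : ∀ {y}, y ++ (v₁ ++ g ++ v₂) ∈ Pref L → y ++ (v₁ ++ g) ∈ Pref L := fun h =>
      mem_pref_of_append (β := v₂) (by simpa using h)
    have hpre' : ∀ {y}, y ++ (v₁ ++ g) ∈ Pref L → y ++ v₁ ∈ Pref L := fun h =>
      mem_pref_of_append (β := g) (by simpa using h)
    rw [Prod.mk.injEq] at he
    have hw₁ := hpre' (hpre hα)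
    have hz₁ := hpre' (hpre hγ)
    have hwl : MNEquiv L (w ++ v₁) (w ++ v₁ ++ g) := by
      simpa using hf _ hw₁ _ (hpre hα) he.1
    have hzl : MNEquiv L (z ++ v₁) (z ++ v₁ ++ g) := by
      simpa using hf _ hz₁ _ (hpre hγ) he.2
    have hwu := hu.append v₁
    have key : MNEquiv L (w ++ v₁) (z ++ v₁) := by
      rcases hb' with ⟨h₁, h₂⟩ | ⟨h₁, h₂⟩
      · exact hL.mnEquiv_of_loop hg hwl hzl hwu hw₁ hz₁ ((append_colexLe_append_iff _).2 h₁)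
          ((append_colexLe_append_iff _).2 h₂)
      · exact hwu.trans (hL.mnEquiv_of_loop hg (hwu.symm.trans (hwl.trans (hwu.append g))) hzl
          hwu.symm (hwu.mem_pref_iff.1 hw₁) hz₁ ((append_colexLe_append_iff _).2 h₁)
          ((append_colexLe_append_iff _).2 h₂))
    simpa using (key.append (g ++ v₂)).symm
  · rw [List.length_append, hv]; omega

/-- The automaton whose states are the left quotients `ψ i` of `L`. -/
def quotientAutomaton (L : Language A) {ρ : Type*} (ψ : ρ → Language A) : NFA A ρ where
  step i a := {j | ψ j = (ψ i).leftQuotient [a]}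
  start := {i | ψ i = L}
  accept := {i | [] ∈ ψ i}

section Quotient

variable {ρ : Type*} {ψ : ρ → Language A} (hψ : Function.Injective ψ)
  (hr : Set.range ψ = L.leftQuotient '' Pref L)

include hr in
theorem mem_eval_quotientAutomaton {α : List A} {i : ρ} :
    i ∈ (quotientAutomaton L ψ).eval α ↔ ψ i = L.leftQuotient α := by
  induction α using List.reverseRecOn generalizing i with
  | nil => simp [quotientAutomaton]
  | append_singleton α a ih =>
    rw [mem_eval_append_singleton, Language.leftQuotient_append]
    constructor
    · rintro ⟨j, hj, hi⟩
      rw [← ih.1 hj]; exact hi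
    · intro hi
      obtain ⟨β, hβ, he⟩ : ψ i ∈ L.leftQuotient '' Pref L := hr ▸ ⟨i, rfl⟩
      have hmem : α ++ [a] ∈ Pref L := by
        have : MNEquiv L β (α ++ [a]) := by
          rw [MNEquiv, Language.leftQuotient_append, he, hi]
        exact this.mem_pref_iff.1 hβ
      obtain ⟨j, hj⟩ : L.leftQuotient α ∈ Set.range ψ :=
        hr ▸ ⟨α, mem_pref_of_append hmem, rfl⟩
      exact ⟨j, ih.2 hj, by rw [← hj] at hi; exact hi⟩

include hr in
theorem accepts_quotientAutomaton : (quotientAutomaton L ψ).accepts = L := by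
  ext α
  constructor
  · rintro ⟨i, hi, hα⟩
    have hi : [] ∈ ψ i := hi
    rw [(mem_eval_quotientAutomaton hr).1 hα] at hi
    simpa using hi
  · intro hα
    obtain ⟨i, hi⟩ : L.leftQuotient α ∈ Set.range ψ := hr ▸ ⟨α, ⟨[], by simpa using hα⟩, rfl⟩
    refine ⟨i, ?_, (mem_eval_quotientAutomaton hr).2 hi⟩
    change [] ∈ ψ i
    rw [hi]; simpa using hα

include hψ hr in
theorem isDFA_quotientAutomaton (hne : (Pref L).Nonempty) : IsDFA (quotientAutomaton L ψ) := by
  have hreach : ∀ i, ∃ α ∈ Pref L, i ∈ (quotientAutomaton L ψ).eval α := by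
    intro i
    obtain ⟨β, hβ, he⟩ : ψ i ∈ L.leftQuotient '' Pref L := hr ▸ ⟨i, rfl⟩
    exact ⟨β, hβ, (mem_eval_quotientAutomaton hr).2 he.symm⟩
  have hsub : ∀ α, ((quotientAutomaton L ψ).eval α).Subsingleton := fun α i hi j hj =>
    hψ (((mem_eval_quotientAutomaton hr).1 hi).trans ((mem_eval_quotientAutomaton hr).1 hj).symm)
  refine ⟨⟨?_, fun i => ?_, fun i => ?_⟩, fun i a j hj k hk => hψ (Eq.trans hj (Eq.symm hk))⟩
  · obtain ⟨α, hα⟩ := hne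
    obtain ⟨i, hi⟩ : L.leftQuotient [] ∈ Set.range ψ :=
      hr ▸ ⟨[], mem_pref_of_append (β := α) hα, rfl⟩
    exact ⟨i, (hsub []).eq_singleton_of_mem ((mem_eval_quotientAutomaton hr).2 hi)⟩
  · obtain ⟨α, -, h⟩ := hreach i
    exact ⟨α, h⟩
  · obtain ⟨α, ⟨γ, hγ⟩, h⟩ := hreach i
    rw [← accepts_quotientAutomaton hr, append_mem_accepts_iff,
      (hsub α).eq_singleton_of_mem h] at hγ
    exact ⟨γ, hγ⟩

end Quotient

/-- The states map onto the left quotients of `L` by prefixes, which themselves form a DFA for `L`;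
minimality makes the map injective. -/
theorem IsMinDFA.isReduced [Fintype σ] (hD : IsMinDFA D) (hDL : D.accepts = L) : IsReduced L D := by
  classical
  subst hDL
  have hmin := hD.2
  have hD := hD.1
  have hpref : ∀ {α}, α ∈ Pref D.accepts ↔ ∃ q, α ∈ incoming D q :=
    mem_pref_iff_eval_nonempty hD.1
  choose w hw using hD.1.2.1
  have hrange : ∀ {α q}, q ∈ D.eval α → D.accepts.leftQuotient α = D.accepts.leftQuotient (w q) :=
    fun h => hD.mnEquiv h (hw _)
  let φ : σ → Set.range fun q => D.accepts.leftQuotient (w q) :=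
    Set.rangeFactorization fun q => D.accepts.leftQuotient (w q)
  have hφ : Function.Surjective φ := Set.rangeFactorization_surjective
  have : Fintype (Set.range fun q => D.accepts.leftQuotient (w q)) := Fintype.ofSurjective φ hφ
  let e := Fintype.equivFin (Set.range fun q => D.accepts.leftQuotient (w q))
  -- Minimality of `D` quantifies over state types in `Type`, hence the indexing by `Fin`.
  let ψ : Fin _ → Language A := fun i => (e.symm i).1
  have hψ : Function.Injective ψ := Subtype.val_injective.comp e.symm.injective
  have hr : Set.range ψ = D.accepts.leftQuotient '' Pref D.accepts := by
    change Set.range (Subtype.val ∘ e.symm) = _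
    rw [e.symm.surjective.range_comp, Subtype.range_val]
    ext K
    constructor
    · rintro ⟨q, rfl⟩
      exact ⟨w q, hpref.2 ⟨q, hw q⟩, rfl⟩
    · rintro ⟨α, hα, rfl⟩
      obtain ⟨q, hq⟩ := hpref.1 hα
      exact ⟨q, (hrange hq).symm⟩
  have hne : (Pref D.accepts).Nonempty := by
    obtain ⟨q, hq⟩ := hD.1.1
    exact ⟨[], hpref.2 ⟨q, by change q ∈ D.start; rw [hq]; rfl⟩⟩
  have hcard := hmin _ (quotientAutomaton D.accepts ψ) (isDFA_quotientAutomaton hψ hr hne)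
    (accepts_quotientAutomaton hr)
  rw [Fintype.card_fin] at hcard
  have hbij := (Fintype.bijective_iff_surjective_and_card φ).2
    ⟨hφ, hcard.antisymm (Fintype.card_le_of_surjective φ hφ)⟩
  refine ⟨hpref, fun {α β q q'} hα hβ => ⟨?_, fun h => ?_⟩, fun q => ⟨w q, hw q⟩⟩
  · rintro rfl
    exact hD.mnEquiv hα hβ
  · exact hbij.1 (Subtype.ext ((hrange hα).symm.trans (Eq.trans h (hrange hβ))))

end Reduced

/-! ### Last letters and the order. -/

section EndLetters

variable {A : Type*} [LinearOrder A]

/-- This is why `Expand` may choose any `α_c`, even a long one: its last letter alone places it in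
the interval. -/
theorem EndBetween.colexLt {m M α : List A} {c : A} (h : EndBetween m M c)
    (hα : α.getLast? = some c) : ColexLt m α ∧ ColexLt α M := by
  obtain ⟨α, rfl⟩ := List.getLast?_eq_some_iff.1 hα
  obtain ⟨h, b, hb, hcb⟩ := h
  obtain ⟨M, rfl⟩ := List.getLast?_eq_some_iff.1 hb
  refine ⟨?_, concat_colexLt_concat_iff.2 (Or.inl hcb)⟩
  rcases List.eq_nil_or_concat' m with rfl | ⟨m, a, rfl⟩
  · exact nil_colexLt (by simp)
  · exact concat_colexLt_concat_iff.2 (Or.inl (h a (by simp)))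

theorem exists_endBetween {m M β : List A} (h₁ : ColexLe m β) (h₂ : ColexLe β M)
    (hm : β.getLast? ≠ m.getLast?) (hM : β.getLast? ≠ M.getLast?) :
    ∃ c, β.getLast? = some c ∧ EndBetween m M c := by
  have h₁ := h₁.lt_of_ne fun h => hm (h ▸ rfl)
  have h₂ := h₂.lt_of_ne fun h => hM (h ▸ rfl)
  rcases List.eq_nil_or_concat' β with rfl | ⟨β, c, rfl⟩
  · exact absurd (nil_colexLe _) h₁.not_le
  rcases List.eq_nil_or_concat' M with rfl | ⟨M, b, rfl⟩
  · exact absurd (nil_colexLe _) h₂.not_le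
  refine ⟨c, by simp, fun a ha => ?_, b, by simp, ?_⟩
  · obtain ⟨m, rfl⟩ := List.getLast?_eq_some_iff.1 ha
    exact (concat_colexLt_concat_iff.1 h₁).resolve_right fun h => hm (by simp [h.1])
  · exact (concat_colexLt_concat_iff.1 h₂).resolve_right fun h => hM (by simp [h.1])

theorem EndBetween.ne {m M : List A} {c : A} (h : EndBetween m M c) :
    m.getLast? ≠ some c ∧ M.getLast? ≠ some c := by
  obtain ⟨h, b, hb, hcb⟩ := h
  refine ⟨fun h' => (h c h').ne rfl, fun h' => hcb.ne ?_⟩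
  rw [Option.mem_def.1 hb] at h'
  exact (Option.some.inj h').symm

end EndLetters

/-! ### The termination measure. -/

section Measure

variable {A : Type*} [Finite A] [LinearOrder A]

/-- The number of strings of length at most `N` in the interval spanned by a pair. -/
noncomputable def intervalCount (N : ℕ) (p : List A × List A) : ℕ :=
  {s | s.length ≤ N ∧ ColexLe p.1 s ∧ ColexLe s p.2}.ncard

/-- The two new intervals are disjoint parts of the old one, and both miss `m'`. -/
theorem intervalCount_add_lt {N : ℕ} {m M m' M₁ m₂ : List A} (hm' : m'.length ≤ N)
    (h₁ : ColexLe m M₁) (h₁' : ColexLt M₁ m') (h₂ : ColexLe m₂ M) (h₂' : ColexLt m' m₂) :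
    intervalCount N (m, M₁) + intervalCount N (m₂, M) < intervalCount N (m, M) := by
  have fin : ∀ p : List A × List A, {s | s.length ≤ N ∧ ColexLe p.1 s ∧ ColexLe s p.2}.Finite :=
    fun p => (List.finite_length_le A N).subset fun _ h => h.1
  unfold intervalCount
  rw [← Set.ncard_union_eq ?_ (fin (m, M₁)) (fin (m₂, M))]
  · refine Set.ncard_lt_ncard ?_ (fin (m, M))
    refine (Set.ssubset_iff_of_subset ?_).2 ⟨m', ⟨hm', (h₁.trans_lt h₁').le, (h₂'.trans_le h₂).le⟩,
      ?_⟩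
    · rintro s (⟨hs, h, h'⟩ | ⟨hs, h, h'⟩)
      · exact ⟨hs, h, h'.trans (h₁'.le.trans (h₂'.le.trans h₂))⟩
      · exact ⟨hs, h₁.trans (h₁'.le.trans (h₂'.le.trans h)), h'⟩
    · rintro (⟨-, -, h⟩ | ⟨-, h, -⟩)
      · exact h₁'.not_le h
      · exact h₂'.not_le h
  · refine Set.disjoint_left.2 fun s hs hs' => ?_
    exact (h₁'.trans h₂').not_le (hs'.2.1.trans hs.2.2)

theorem sum_intervalCount_split_lt {N : ℕ} {τ : Finset (List A × List A)} {m M m' M₁ m₂ : List A}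
    (hp : (m, M) ∈ τ) (hm' : m'.length ≤ N)
    (h₁ : ColexLe m M₁) (h₁' : ColexLt M₁ m') (h₂ : ColexLe m₂ M) (h₂' : ColexLt m' m₂) :
    ∑ p ∈ τ.erase (m, M) ∪ {(m, M₁), (m₂, M)}, intervalCount N p < ∑ p ∈ τ, intervalCount N p := by
  have hne : (m, M₁) ≠ (m₂, M) := fun h => by
    have h₃ : m = m₂ := congrArg Prod.fst h
    exact (h₁.trans_lt (h₁'.trans h₂')).not_le (Or.inr h₃.symm)
  -- Only an inequality, since a new pair might already belong to `τ`.
  calc _ ≤ ∑ p ∈ τ.erase (m, M), intervalCount N p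
        + ∑ p ∈ {(m, M₁), (m₂, M)}, intervalCount N p := by
        rw [← Finset.sum_union_inter]; exact Nat.le_add_right _ _
    _ < ∑ p ∈ τ.erase (m, M), intervalCount N p + intervalCount N (m, M) := by
        rw [Finset.sum_pair hne]
        exact Nat.add_lt_add_left (intervalCount_add_lt hm' h₁ h₁' h₂ h₂') _
    _ = _ := Finset.sum_erase_add _ _ hp

end Measure

/-! ### The loop invariant, termination and correctness of `Expand`. -/

section Run

variable {A : Type*} [LinearOrder A] {σ : Type*} [Fintype σ] {L : Language A} {D : NFA A σ}

omit [LinearOrder A] in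
theorem shortIncoming_finite [Finite A] (D : NFA A σ) (q : σ) : (shortIncoming D q).Finite :=
  (List.finite_length_le A _).subset fun _ h => h.2

/-- Two pairs are separated by a prefix of `L` outside of their Myhill-Nerode class. -/
def Separated (L : Language A) (p p' : List A × List A) : Prop :=
  ∃ γ ∈ Pref L, ¬ MNEquiv L γ p.1 ∧
    (ColexLt p.2 γ ∧ ColexLt γ p'.1 ∨ ColexLt p'.2 γ ∧ ColexLt γ p.1)

/-- The loop invariant of the algorithm. -/
structure LoopInvariant (L : Language A) (D : NFA A σ) (τ : Finset (List A × List A)) : Prop where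
  endpoints : ∀ p ∈ τ, ∃ q, p.1 ∈ shortIncoming D q ∧ p.2 ∈ shortIncoming D q ∧ ColexLe p.1 p.2
  cover : ∀ q, ∀ γ ∈ shortIncoming D q,
    ∃ p ∈ τ, p.1 ∈ incoming D q ∧ ColexLe p.1 γ ∧ ColexLe γ p.2
  separated : ∀ p ∈ τ, ∀ p' ∈ τ, p ≠ p' → MNEquiv L p.1 p'.1 → Separated L p p'

theorem IsReduced.exists_isMinMaxPairs [Finite A] (hD : IsReduced L D) :
    ∃ τ, IsMinMaxPairs D τ := by
  have hne : ∀ q, (shortIncoming D q).Nonempty := by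
    intro q
    obtain ⟨α, hα⟩ := hD.exists_mem q
    obtain ⟨β, hβ, hl⟩ := hD.exists_mnEquiv_length_le (hD.mem_pref_iff.2 ⟨q, hα⟩)
    obtain ⟨q', hq'⟩ := hD.mem_pref_iff.1
      (hβ.mem_pref_iff.1 (hD.mem_pref_iff.2 ⟨q, hα⟩))
    obtain rfl := (hD.eq_iff hα hq').2 hβ
    exact ⟨β, hq', hl.trans (Nat.le_add_left _ _)⟩
  choose m hm using fun q => exists_isColexMin (shortIncoming_finite D q) (hne q)
  choose M hM using fun q => exists_isColexMax (shortIncoming_finite D q) (hne q)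
  exact ⟨_, m, M, fun q => ⟨hm q, hM q⟩, rfl⟩

theorem IsMinMaxPairs.loopInvariant (hD : IsReduced L D) {τ : Finset (List A × List A)}
    (h : IsMinMaxPairs D τ) : LoopInvariant L D τ := by
  obtain ⟨m, M, h, rfl⟩ := h
  refine ⟨fun p hp => ?_, fun q γ hγ => ?_, fun p hp p' hp' hne he => ?_⟩
  · obtain ⟨q, -, rfl⟩ := Finset.mem_image.1 hp
    exact ⟨q, (h q).1.1, (h q).2.1, (h q).1.2 _ (h q).2.1⟩
  · exact ⟨(m q, M q), Finset.mem_image_of_mem _ (Finset.mem_univ q), (h q).1.1.1,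
      (h q).1.2 γ hγ, (h q).2.2 γ hγ⟩
  · obtain ⟨q, -, rfl⟩ := Finset.mem_image.1 hp
    obtain ⟨q', -, rfl⟩ := Finset.mem_image.1 hp'
    exact absurd ((hD.eq_iff (h q).1.1.1 (h q').1.1.1).2 he) fun h => hne (h ▸ rfl)

section Invariant

variable {τ : Finset (List A × List A)}

theorem LoopInvariant.mnEquiv (hD : IsReduced L D) (hτ : LoopInvariant L D τ)
    {p : List A × List A} (hp : p ∈ τ) : MNEquiv L p.1 p.2 := by
  obtain ⟨q, h₁, h₂, -⟩ := hτ.endpoints p hp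
  exact (hD.eq_iff h₁.1 h₂.1).1 rfl

theorem LoopInvariant.mem_pref (hD : IsReduced L D) (hτ : LoopInvariant L D τ)
    {p : List A × List A} (hp : p ∈ τ) : p.1 ∈ Pref L := by
  obtain ⟨q, h₁, -⟩ := hτ.endpoints p hp
  exact hD.mem_pref_iff.2 ⟨q, h₁.1⟩

theorem LoopInvariant.exists_isGreatestSmaller [Finite A] (hτ : LoopInvariant L D τ)
    {p p' : List A × List A} (hp : p ∈ τ) (h : Overlap p p') :
    ∃ M₁, IsGreatestSmaller D p.1 p'.1 M₁ := by
  obtain ⟨q, h₁, -⟩ := hτ.endpoints p hp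
  obtain ⟨x, hx⟩ := exists_isColexMax (S := {y | y ∈ shortIncoming D q ∧ ColexLt y p'.1})
    ((shortIncoming_finite D q).subset fun _ h => h.1) ⟨p.1, h₁, h.1⟩
  exact ⟨x, q, h₁.1, hx⟩

theorem LoopInvariant.exists_isSmallestGreater [Finite A] (hτ : LoopInvariant L D τ)
    {p p' : List A × List A} (hp : p ∈ τ) (h : Overlap p p') :
    ∃ m₂, IsSmallestGreater D p.1 p'.1 m₂ := by
  obtain ⟨q, h₁, h₂, -⟩ := hτ.endpoints p hp
  obtain ⟨x, hx⟩ := exists_isColexMin (S := {y | y ∈ shortIncoming D q ∧ ColexLt p'.1 y})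
    ((shortIncoming_finite D q).subset fun _ h => h.1) ⟨p.2, h₂, h.2⟩
  exact ⟨x, q, h₁.1, hx⟩

/-- Separated pairs have disjoint intervals, whereas here `m'` lies inside the first one. -/
theorem LoopInvariant.not_mnEquiv_of_overlap (hτ : LoopInvariant L D τ)
    {p p' : List A × List A} (hp : p ∈ τ) (hp' : p' ∈ τ) (h : Overlap p p') :
    ¬ MNEquiv L p.1 p'.1 := by
  intro he
  have hne : p ≠ p' := fun e => colexLt_irrefl p.1 (by simpa [← e] using h.1)
  obtain ⟨γ, -, -, ⟨h₁, h₂⟩ | ⟨h₁, h₂⟩⟩ := hτ.separated p hp p' hp' hne he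
  · exact (h₁.trans h₂).not_le h.2.le
  · obtain ⟨-, -, -, hle⟩ := hτ.endpoints p' hp'
    exact (h₁.trans h₂).not_le (h.1.le.trans hle)

theorem LoopInvariant.split_bounds (hD : IsReduced L D) (hτ : LoopInvariant L D τ)
    {m M m' M₁ m₂ : List A} (hp : (m, M) ∈ τ) (h : ColexLt m m' ∧ ColexLt m' M)
    (h₁ : IsGreatestSmaller D m m' M₁) (h₂ : IsSmallestGreater D m m' m₂) :
    ∃ q, m ∈ shortIncoming D q ∧ M ∈ shortIncoming D q ∧ M₁ ∈ shortIncoming D q ∧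
      m₂ ∈ shortIncoming D q ∧ ColexLe m M₁ ∧ ColexLt M₁ m' ∧ ColexLt m' m₂ ∧ ColexLe m₂ M ∧
      ∀ γ ∈ shortIncoming D q, (ColexLt γ m' → ColexLe γ M₁) ∧ (ColexLt m' γ → ColexLe m₂ γ) := by
  obtain ⟨q, hm, hM, -⟩ := hτ.endpoints _ hp
  obtain ⟨q₁, hq₁, h₁⟩ := h₁
  obtain ⟨q₂, hq₂, h₂⟩ := h₂
  obtain rfl := (hD.eq_iff hm.1 hq₁).2 rfl
  obtain rfl := (hD.eq_iff hm.1 hq₂).2 rfl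
  exact ⟨q, hm, hM, h₁.1.1, h₂.1.1, h₁.2 _ ⟨hm, h.1⟩, h₁.1.2, h₂.1.2, h₂.2 _ ⟨hM, h.2⟩,
    fun γ hγ => ⟨fun h => h₁.2 γ ⟨hγ, h⟩, fun h => h₂.2 γ ⟨hγ, h⟩⟩⟩

/-- The string `m'` lies outside the class of `m`, so it separates the two new pairs. Shrinking
intervals keeps the older separators valid, and the extremality of `M₁` and `m₂` ensures that no
short string of the state is lost. -/
theorem LoopInvariant.split (hD : IsReduced L D) (hτ : LoopInvariant L D τ)
    {m M m' M' M₁ m₂ : List A} (hp : (m, M) ∈ τ) (hp' : (m', M') ∈ τ)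
    (h : Overlap (m, M) (m', M')) (h₁ : IsGreatestSmaller D m m' M₁)
    (h₂ : IsSmallestGreater D m m' m₂) :
    LoopInvariant L D (τ.erase (m, M) ∪ {(m, M₁), (m₂, M)}) := by
  have hnot : ¬ MNEquiv L m m' := hτ.not_mnEquiv_of_overlap hp hp' h
  have hm'P : m' ∈ Pref L := hτ.mem_pref hD hp'
  obtain ⟨q, hm, hM, hM₁, hm₂, hmM₁, hM₁m', hm'm₂, hm₂M, hbest⟩ := hτ.split_bounds hD hp h h₁ h₂
  have hmm₂ : MNEquiv L m₂ m := (hD.eq_iff hm₂.1 hm.1).1 rfl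
  have hmem : ∀ r, r ∈ τ.erase (m, M) ∪ {(m, M₁), (m₂, M)} ↔
      (r ≠ (m, M) ∧ r ∈ τ) ∨ r = (m, M₁) ∨ r = (m₂, M) := fun r => by
    rw [Finset.mem_union, Finset.mem_erase, Finset.mem_insert, Finset.mem_singleton]
  have hparent : ∀ r ∈ τ.erase (m, M) ∪ {(m, M₁), (m₂, M)}, ∃ s ∈ τ, ColexLe s.1 r.1 ∧
      ColexLe r.2 s.2 ∧ MNEquiv L r.1 s.1 ∧
      (s = r ∧ s ≠ (m, M) ∨ s = (m, M) ∧ (r = (m, M₁) ∨ r = (m₂, M))) := by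
    intro r hr
    rcases (hmem r).1 hr with ⟨hr, hrτ⟩ | rfl | rfl
    · exact ⟨r, hrτ, ColexLe.refl _, ColexLe.refl _, MNEquiv.refl _, Or.inl ⟨rfl, hr⟩⟩
    · exact ⟨_, hp, ColexLe.refl _, hM₁m'.le.trans (hm'm₂.le.trans hm₂M), MNEquiv.refl _,
        Or.inr ⟨rfl, Or.inl rfl⟩⟩
    · exact ⟨_, hp, hmM₁.trans (hM₁m'.trans hm'm₂).le, ColexLe.refl _, hmm₂,
        Or.inr ⟨rfl, Or.inr rfl⟩⟩
  refine ⟨fun r hr => ?_, fun q' γ hγ => ?_, fun r hr r' hr' hne he => ?_⟩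
  · rcases (hmem r).1 hr with ⟨-, hrτ⟩ | rfl | rfl
    · exact hτ.endpoints r hrτ
    · exact ⟨q, hm, hM₁, hmM₁⟩
    · exact ⟨q, hm₂, hM, hm₂M⟩
  · obtain ⟨p, hpτ, hpq, hpγ, hγp⟩ := hτ.cover q' γ hγ
    by_cases hpm : p = (m, M)
    · subst hpm
      obtain rfl := (hD.eq_iff hm.1 hpq).2 rfl
      rcases colexLe_or_lt γ m' with hγm' | hγm'
      · have hγm' := hγm'.lt_of_ne fun e => hnot ((hD.eq_iff hm.1 (e ▸ hγ.1)).1 rfl)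
        exact ⟨_, (hmem _).2 (Or.inr (Or.inl rfl)), hpq, hpγ, (hbest γ hγ).1 hγm'⟩
      · exact ⟨_, (hmem _).2 (Or.inr (Or.inr rfl)), hm₂.1, (hbest γ hγ).2 hγm', hγp⟩
    · exact ⟨p, (hmem p).2 (Or.inl ⟨hpm, hpτ⟩), hpq, hpγ, hγp⟩
  · obtain ⟨s, hs, hsr, hrs, hes, hcase⟩ := hparent r hr
    obtain ⟨s', hs', hsr', hrs', hes', hcase'⟩ := hparent r' hr'
    by_cases hss : s = s'
    · subst hss
      rcases hcase with ⟨rfl, hsp⟩ | ⟨rfl, hcase⟩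
      · rcases hcase' with ⟨rfl, -⟩ | ⟨rfl, -⟩
        · exact absurd rfl hne
        · exact absurd rfl hsp
      · rcases hcase' with ⟨-, h⟩ | ⟨-, hcase'⟩
        · exact absurd rfl h
        refine ⟨m', hm'P, fun h => hnot (h.trans hes).symm, ?_⟩
        rcases hcase with rfl | rfl <;> rcases hcase' with rfl | rfl
        · exact absurd rfl hne
        · exact Or.inl ⟨hM₁m', hm'm₂⟩
        · exact Or.inr ⟨hM₁m', hm'm₂⟩
        · exact absurd rfl hne
    · obtain ⟨γ, hγ, hγs, hb⟩ := hτ.separated s hs s' hs' hss (hes.symm.trans (he.trans hes'))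
      exact ⟨γ, hγ, fun h => hγs (h.trans hes), hb.imp
        (fun h => ⟨hrs.trans_lt h.1, h.2.trans_le hsr'⟩)
        fun h => ⟨hrs'.trans_lt h.1, h.2.trans_le hsr⟩⟩

/-- At the exit of the loop every pair spans an interval within one Myhill-Nerode class. -/
theorem LoopInvariant.mnEquiv_of_mem_interval (hD : IsReduced L D) (hL : IsWheelerLanguage L)
    (hτ : LoopInvariant L D τ) (hno : ∀ p ∈ τ, ∀ p' ∈ τ, ¬ Overlap p p')
    {p : List A × List A} (hp : p ∈ τ) {γ : List A} (hγ : γ ∈ Pref L)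
    (h₁ : ColexLe p.1 γ) (h₂ : ColexLe γ p.2) : MNEquiv L γ p.1 := by
  by_contra hn
  have hp₁P := hτ.mem_pref hD hp
  have hp₁₂ := hτ.mnEquiv hD hp
  obtain ⟨β, hβ, hβl⟩ := hD.exists_convEquiv_length_le hL hγ
  -- Were `β` not strictly inside the interval, an endpoint would lie between `β` and `γ` and hence
  -- in their class.
  have hβ₁ : ColexLt p.1 β := (colexLe_or_lt β p.1).resolve_left fun h =>
    hn (hβ.of_between hp₁P (Or.inr ⟨h, h₁⟩)).1
  have hβ₂ : ColexLt β p.2 := (colexLe_or_lt p.2 β).resolve_left fun h =>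
    hn ((hβ.of_between (hp₁₂.mem_pref_iff.1 hp₁P) (Or.inl ⟨h₂, h⟩)).1.trans hp₁₂.symm)
  obtain ⟨q, hq⟩ := hD.mem_pref_iff.1 (hβ.mem_pref_iff.1 hγ)
  obtain ⟨p', hp', hp'q, hp'β, hβp'⟩ := hτ.cover q β ⟨hq, hβl⟩
  have he : MNEquiv L γ p'.1 := hβ.1.trans ((hD.eq_iff hq hp'q).1 rfl)
  -- Both intervals contain `β`, so whichever starts later has its left end inside the other: an
  -- overlap.
  rcases colexLe_or_lt p'.1 p.1 with h | h
  · rcases h with h | h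
    · exact hno p' hp' p hp ⟨h, hβ₁.trans_le hβp'⟩
    · exact hn (h ▸ he)
  · exact hno p hp p' hp' ⟨h, hp'β.trans_lt hβ₂⟩

theorem LoopInvariant.convEquiv_of_mem_interval (hD : IsReduced L D) (hL : IsWheelerLanguage L)
    (hτ : LoopInvariant L D τ) (hno : ∀ p ∈ τ, ∀ p' ∈ τ, ¬ Overlap p p')
    {p : List A × List A} (hp : p ∈ τ) {α β : List A} (hα : α ∈ Pref L) (hβ : β ∈ Pref L)
    (hα₁ : ColexLe p.1 α) (hα₂ : ColexLe α p.2) (hβ₁ : ColexLe p.1 β) (hβ₂ : ColexLe β p.2)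
    (he : α.getLast? = β.getLast?) : ConvEquiv L α β := by
  have key := fun {γ} => hτ.mnEquiv_of_mem_interval hD hL hno hp (γ := γ)
  refine convEquiv_iff.2 ⟨(key hα hα₁ hα₂).trans (key hβ hβ₁ hβ₂).symm, he, fun γ hγ hb => ?_⟩
  refine MNEquiv.trans ?_ (key hα hα₁ hα₂).symm
  rcases hb with ⟨h, h'⟩ | ⟨h, h'⟩
  · exact key hγ (hα₁.trans h) (h'.trans hβ₂)
  · exact key hγ (hβ₁.trans h) (h'.trans hα₂)

/-- At the exit of the loop the intervals of distinct pairs meet distinct Wheeler classes. -/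
theorem LoopInvariant.eq_of_convEquiv (hD : IsReduced L D) (hL : IsWheelerLanguage L)
    (hτ : LoopInvariant L D τ) (hno : ∀ p ∈ τ, ∀ p' ∈ τ, ¬ Overlap p p')
    {p p' : List A × List A} (hp : p ∈ τ) (hp' : p' ∈ τ) {α β : List A} (hα : α ∈ Pref L)
    (hα₁ : ColexLe p.1 α) (hα₂ : ColexLe α p.2) (hβ₁ : ColexLe p'.1 β) (hβ₂ : ColexLe β p'.2)
    (h : ConvEquiv L α β) : p = p' := by
  by_contra hne
  have hαp := hτ.mnEquiv_of_mem_interval hD hL hno hp hα hα₁ hα₂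
  have hβp' := hτ.mnEquiv_of_mem_interval hD hL hno hp' (h.mem_pref_iff.1 hα) hβ₁ hβ₂
  obtain ⟨γ, hγ, hn, hb⟩ := hτ.separated p hp p' hp' hne (hαp.symm.trans (h.1.trans hβp'))
  refine hn (MNEquiv.trans ((convEquiv_iff.1 h).2.2 γ hγ ?_) hαp)
  exact hb.imp (fun hb => ⟨hα₂.trans hb.1.le, hb.2.le.trans hβ₁⟩)
    fun hb => ⟨hβ₂.trans hb.1.le, hb.2.le.trans hα₁⟩

omit [Fintype σ] in
theorem exists_isExpand [Finite A] (D : NFA A σ) (τ : Finset (List A × List A)) :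
    ∃ τ', IsExpand D τ τ' := by
  have h : ∀ p ∈ τ, ∀ c, (∃ α, EndsAt D p.1 c α) → ∃ α, EndsAt D p.1 c α := fun _ _ _ h => h
  choose! w hw using h
  have hfin : {x | ∃ p ∈ τ, (p.1.getLast? = p.2.getLast? ∧ x = p) ∨
      (p.1.getLast? ≠ p.2.getLast? ∧ (x = (p.1, p.1) ∨ x = (p.2, p.2) ∨
        ∃ c, EndBetween p.1 p.2 c ∧ (∃ α, EndsAt D p.1 c α) ∧ x = (w p c, w p c)))}.Finite := by
    refine (τ.finite_toSet.biUnion (t := fun p => {p, (p.1, p.1), (p.2, p.2)} ∪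
      Set.range fun c => (w p c, w p c)) fun p _ => Set.toFinite _).subset ?_
    rintro x ⟨p, hp, ⟨-, rfl⟩ | ⟨-, rfl | rfl | ⟨c, -, -, rfl⟩⟩⟩ <;>
      refine Set.mem_biUnion hp ?_ <;> simp
  exact ⟨hfin.toFinset, w, hw, fun x => hfin.mem_toFinset⟩

/-- Two prefixes in intervals of `τ` are `ConvEquiv` exactly if they have the same interval and the
same last letter. Short representatives and `cover` ensure that every class meets an interval. -/
theorem LoopInvariant.isFingerprint (hD : IsReduced L D) (hL : IsWheelerLanguage L)
    (hτ : LoopInvariant L D τ) (hno : ∀ p ∈ τ, ∀ p' ∈ τ, ¬ Overlap p p')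
    {τ' : Finset (List A × List A)} (hx : IsExpand D τ τ') :
    IsFingerprint L (τ'.image Prod.fst) := by
  obtain ⟨w, hw, hmem⟩ := hx
  have hP₁ := fun {p} => hτ.mem_pref hD (p := p)
  have hP₂ : ∀ {p}, p ∈ τ → p.2 ∈ Pref L := fun hp =>
    (hτ.mnEquiv hD hp).mem_pref_iff.1 (hP₁ hp)
  have hle : ∀ {p}, p ∈ τ → ColexLe p.1 p.2 := fun hp => by
    obtain ⟨-, -, -, h⟩ := hτ.endpoints _ hp
    exact h
  have hwmem : ∀ {p c}, p ∈ τ → EndBetween p.1 p.2 c → (∃ α, EndsAt D p.1 c α) →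
      w p c ∈ Pref L ∧ (w p c).getLast? = some c ∧ ColexLt p.1 (w p c) ∧ ColexLt (w p c) p.2 := by
    intro p c hp hc hα
    obtain ⟨⟨q, -, hq⟩, hl⟩ := hw p hp c hα
    exact ⟨hD.mem_pref_iff.2 ⟨q, hq⟩, hl, hc.colexLt hl⟩
  have hinterval : ∀ p ∈ τ, ∀ x, (p.1.getLast? = p.2.getLast? ∧ x = p) ∨
      (p.1.getLast? ≠ p.2.getLast? ∧ (x = (p.1, p.1) ∨ x = (p.2, p.2) ∨
        ∃ c, EndBetween p.1 p.2 c ∧ (∃ α, EndsAt D p.1 c α) ∧ x = (w p c, w p c))) →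
      x.1 ∈ Pref L ∧ ColexLe p.1 x.1 ∧ ColexLe x.1 p.2 := by
    intro p hp x hx
    have h₁ := hP₁ hp
    have h₂ := hP₂ hp
    have h₃ := hle hp
    rcases hx with ⟨-, rfl⟩ | ⟨-, rfl | rfl | ⟨c, hc, hα, rfl⟩⟩
    · exact ⟨h₁, ColexLe.refl _, h₃⟩
    · exact ⟨h₁, ColexLe.refl _, h₃⟩
    · exact ⟨h₂, h₃, ColexLe.refl _⟩
    · obtain ⟨h₁, -, h₂, h₃⟩ := hwmem hp hc hα
      exact ⟨h₁, h₂.le, h₃.le⟩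
  refine isFingerprint_iff.2 ⟨fun α hα => ?_, fun α hα => ?_⟩
  · obtain ⟨x, hx, rfl⟩ := Finset.mem_image.1 hα
    obtain ⟨p, hp, h⟩ := (hmem x).1 hx
    exact (hinterval p hp x h).1
  refine existsUnique_of_exists_of_unique ?_ ?_
  · obtain ⟨β, hβ, hβl⟩ := hD.exists_convEquiv_length_le hL hα
    have hβP := hβ.mem_pref_iff.1 hα
    obtain ⟨q, hq⟩ := hD.mem_pref_iff.1 hβP
    obtain ⟨p, hp, hpq, h₁, h₂⟩ := hτ.cover q β ⟨hq, hβl⟩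
    suffices h : ∃ x ∈ τ', β.getLast? = x.1.getLast? ∧ x.1 ∈ Pref L ∧
        ColexLe p.1 x.1 ∧ ColexLe x.1 p.2 by
      obtain ⟨x, hx, he, hxP, hx₁, hx₂⟩ := h
      exact ⟨x.1, Finset.mem_image_of_mem _ hx, hβ.trans
        (hτ.convEquiv_of_mem_interval hD hL hno hp hβP hxP h₁ h₂ hx₁ hx₂ he)⟩
    suffices h : ∃ x, β.getLast? = x.1.getLast? ∧ ((p.1.getLast? = p.2.getLast? ∧ x = p) ∨
        (p.1.getLast? ≠ p.2.getLast? ∧ (x = (p.1, p.1) ∨ x = (p.2, p.2) ∨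
        ∃ c, EndBetween p.1 p.2 c ∧ (∃ α, EndsAt D p.1 c α) ∧ x = (w p c, w p c)))) by
      obtain ⟨x, he, hx⟩ := h
      exact ⟨x, (hmem x).2 ⟨p, hp, hx⟩, he, hinterval p hp x hx⟩
    by_cases he : p.1.getLast? = p.2.getLast?
    · exact ⟨p, Between.getLast?_eq (Or.inl ⟨h₁, h₂⟩) he, Or.inl ⟨he, rfl⟩⟩
    by_cases he₁ : β.getLast? = p.1.getLast?
    · exact ⟨(p.1, p.1), he₁, Or.inr ⟨he, Or.inl rfl⟩⟩
    by_cases he₂ : β.getLast? = p.2.getLast?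
    · exact ⟨(p.2, p.2), he₂, Or.inr ⟨he, Or.inr (Or.inl rfl)⟩⟩
    obtain ⟨c, hc, hb⟩ := exists_endBetween h₁ h₂ he₁ he₂
    -- `β` itself shows that `Expand` adds a pair for the letter `c`.
    have hα : ∃ α, EndsAt D p.1 c α := ⟨β, ⟨q, hpq, hq⟩, hc⟩
    exact ⟨(w p c, w p c), hc.trans (hwmem hp hb hα).2.1.symm,
      Or.inr ⟨he, Or.inr (Or.inr ⟨c, hb, hα, rfl⟩)⟩⟩
  · rintro _ _ ⟨hx, hαx⟩ ⟨hy, hαy⟩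
    obtain ⟨x, hxτ, rfl⟩ := Finset.mem_image.1 hx
    obtain ⟨y, hyτ, rfl⟩ := Finset.mem_image.1 hy
    obtain ⟨p, hp, hxp⟩ := (hmem x).1 hxτ
    obtain ⟨p', hp', hyp⟩ := (hmem y).1 hyτ
    have hxy := hαx.symm.trans hαy
    obtain ⟨hxP, hx₁, hx₂⟩ := hinterval p hp x hxp
    obtain ⟨-, hy₁, hy₂⟩ := hinterval p' hp' y hyp
    obtain rfl := hτ.eq_of_convEquiv hD hL hno hp hp' hxP hx₁ hx₂ hy₁ hy₂ hxy
    have he := hxy.2.1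
    rcases hxp with ⟨h, rfl⟩ | ⟨h, hxp⟩
    · rcases hyp with ⟨-, rfl⟩ | ⟨h', -⟩
      · rfl
      · exact absurd h h'
    replace hyp := (hyp.resolve_left fun h' => h h'.1).2
    rcases hxp with rfl | rfl | ⟨c, hc, hα, rfl⟩ <;> rcases hyp with rfl | rfl | ⟨d, hd, hα', rfl⟩
    · rfl
    · exact absurd he h
    · exact absurd (he.trans (hwmem hp hd hα').2.1) hd.ne.1
    · exact absurd he.symm h
    · rfl
    · exact absurd (he.trans (hwmem hp hd hα').2.1) hd.ne.2
    · exact absurd (he.symm.trans (hwmem hp hc hα).2.1) hc.ne.1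
    · exact absurd (he.symm.trans (hwmem hp hc hα).2.1) hc.ne.2
    · obtain rfl : c = d := Option.some.inj
        ((hwmem hp hc hα).2.1.symm.trans (he.trans (hwmem hp hd hα').2.1))
      rfl

end Invariant

theorem Reachable.loopInvariant (hD : IsReduced L D) {τ : Finset (List A × List A)}
    (h : Reachable D (.loop τ)) : LoopInvariant L D τ := by
  suffices ∀ c, Reachable D c → ∀ τ, c = .loop τ → LoopInvariant L D τ from this _ h τ rfl
  intro c hc
  induction hc with
  | refl => rintro τ ⟨⟩
  | tail _ hstep ih =>
    intro τ hτ
    cases hstep with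
    | init h => cases hτ; exact h.loopInvariant hD
    | iterate hp hp' h h₁ h₂ => cases hτ; exact (ih _ rfl).split hD hp hp' h h₁ h₂
    | exit h hx => cases hτ

theorem Reachable.isFingerprint (hD : IsReduced L D) (hL : IsWheelerLanguage L)
    {F : Finset (List A)} (h : Reachable D (.done F)) : IsFingerprint L F := by
  rcases Relation.ReflTransGen.cases_tail h with h | ⟨c, hc, hstep⟩
  · cases h
  · cases hstep with
    | exit hno hx => exact (Reachable.loopInvariant hD hc).isFingerprint hD hL hno hx

theorem Reachable.exists_step [Finite A] (hD : IsReduced L D) {c : Config A}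
    (h : Reachable D c) : (∃ F, c = .done F) ∨ ∃ c', Step D c c' := by
  cases c with
  | start =>
    obtain ⟨τ, hτ⟩ := hD.exists_isMinMaxPairs
    exact Or.inr ⟨_, .init hτ⟩
  | loop τ =>
    right
    have hτ := Reachable.loopInvariant hD h
    by_cases hno : ∀ p ∈ τ, ∀ p' ∈ τ, ¬ Overlap p p'
    · obtain ⟨τ', hx⟩ := exists_isExpand D τ
      exact ⟨_, .exit hno hx⟩
    · push Not at hno
      obtain ⟨⟨m, M⟩, hp, ⟨m', M'⟩, hp', ho⟩ := hno
      obtain ⟨M₁, h₁⟩ := hτ.exists_isGreatestSmaller hp ho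
      obtain ⟨m₂, h₂⟩ := hτ.exists_isSmallestGreater hp ho
      exact ⟨_, .iterate hp hp' ho h₁ h₂⟩
  | done F => exact Or.inl ⟨F, rfl⟩

theorem not_exists_infinite_run [Finite A] (hD : IsReduced L D) :
    ¬ ∃ run : ℕ → Config A, run 0 = .start ∧ ∀ i, Step D (run i) (run (i + 1)) := by
  rintro ⟨run, h0, hrun⟩
  have hreach : ∀ i, Reachable D (run i) := by
    intro i
    induction i with
    | zero => rw [h0]; exact .refl
    | succ i ih => exact .tail ih (hrun i)
  have main : ∀ k i τ, run i = .loop τ →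
      ∑ p ∈ τ, intervalCount (Fintype.card σ ^ 2 + Fintype.card σ) p ≠ k := by
    intro k
    induction k using Nat.strong_induction_on with
    | _ k ih =>
      rintro i τ hi rfl
      have hstep := hrun i
      have hτ : LoopInvariant L D τ := Reachable.loopInvariant hD (hi ▸ hreach i)
      rw [hi] at hstep
      generalize hc : run (i + 1) = c at hstep
      cases hstep with
      | iterate hp hp' h h₁ h₂ =>
        obtain ⟨q, -, -, -, -, hmM₁, hM₁m', hm'm₂, hm₂M, -⟩ := hτ.split_bounds hD hp h h₁ h₂
        obtain ⟨_, hm', -⟩ := hτ.endpoints _ hp'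
        exact ih _ (sum_intervalCount_split_lt hp hm'.2 hmM₁ hM₁m' hm₂M hm'm₂) _ _ hc rfl
      -- A returned configuration has no successor.
      | exit h hx =>
        have := hrun (i + 1)
        rw [hc] at this
        cases this
  have hstep := hrun 0
  rw [h0] at hstep
  generalize hc : run (0 + 1) = c at hstep
  cases hstep with
  | init h => exact main _ _ _ hc rfl

end Run

/-! ### The automaton built from a fingerprint. -/

section Construction

variable {A : Type*} [LinearOrder A] {L : Language A} {F : Finset (List A)}

/-- The representative of `x` in `F` is not strictly between `s` and `t`; by convexity its class
reaches `s` or `t` on the way to `x`. -/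
theorem Consecutive.convEquiv_or (hF : IsFingerprint L F) {s t x : List A}
    (h : Consecutive F s t) (hs : ColexLe s x) (ht : ColexLe x t) (hx : x ∈ Pref L) :
    ConvEquiv L x s ∨ ConvEquiv L x t := by
  rw [isFingerprint_iff] at hF
  obtain ⟨ρ, ⟨hρF, hρ⟩, -⟩ := hF.2 x hx
  rcases colexLe_or_lt ρ s with h₁ | h₁
  · exact Or.inl (hρ.of_between (hF.1 s h.1) (Or.inr ⟨h₁, hs⟩))
  · rcases colexLe_or_lt t ρ with h₂ | h₂
    · exact Or.inr (hρ.of_between (hF.1 t h.2.1) (Or.inl ⟨ht, h₂⟩))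
    · exact absurd ⟨h₁, h₂⟩ (h.2.2.2 ρ hρF)

theorem Consecutive.mnEquiv (hF : IsFingerprint L F) {s t x γ : List A}
    (h : Consecutive F s t) (hs : MNEquiv L s x) (ht : MNEquiv L x t)
    (hγs : ColexLe s γ) (hγt : ColexLe γ t) (hγ : γ ∈ Pref L) : MNEquiv L γ x := by
  rcases h.convEquiv_or hF hγs hγt hγ with h | h
  · exact h.1.trans hs
  · exact h.1.trans ht.symm

theorem Selects.convEquiv (hF : IsFingerprint L F) {x β : List A} (hx : x ∈ Pref L)
    (h : Selects L F x β) : β ∈ F ∧ ConvEquiv L x β := by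
  have hF' := isFingerprint_iff.1 hF
  obtain ⟨ρ, ⟨hρF, hρ⟩, -⟩ := hF'.2 x hx
  rcases h with ⟨h₁, h₂⟩ | ⟨h₁, h₂⟩ | ⟨s, t, hc, hs, ht, h⟩
  · exact ⟨h₂.1, hρ.of_between (hF'.1 _ h₂.1) (Or.inl ⟨h₁ _ h₂.1, h₂.2 _ hρF⟩)⟩
  · exact ⟨h₂.1, hρ.of_between (hF'.1 _ h₂.1) (Or.inr ⟨h₂.2 _ hρF, h₁ _ h₂.1⟩)⟩
  · have hor := hc.convEquiv_or hF hs ht hx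
    rcases h with ⟨_, h₂, rfl⟩ | ⟨h₁, _, rfl⟩ | ⟨h₁, h₂, ⟨h₃, rfl⟩ | ⟨h₃, rfl⟩⟩
    · exact ⟨hc.1, hor.resolve_right fun h => h₂ h.1⟩
    · exact ⟨hc.2.1, hor.resolve_left fun h => h₁ h.1.symm⟩
    · refine ⟨hc.1, convEquiv_iff.2 ⟨h₁.symm, h₃, fun γ hγ hb => ?_⟩⟩
      refine hc.mnEquiv hF h₁ h₂ ?_ ?_ hγ
      · exact hb.elim (fun h => hs.trans h.1) fun h => h.1
      · exact hb.elim (fun h => h.2.trans (hs.trans ht)) fun h => h.2.trans ht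
    · refine ⟨hc.2.1, convEquiv_iff.2 ⟨h₂, h₃, fun γ hγ hb => ?_⟩⟩
      refine hc.mnEquiv hF h₁ h₂ ?_ ?_ hγ
      · exact hb.elim (fun h => hs.trans h.1) fun h => (hs.trans ht).trans h.1
      · exact hb.elim (fun h => h.2) fun h => h.2.trans ht

theorem selects_iff (hF : IsFingerprint L F) {x β : List A} (hx : x ∈ Pref L) :
    Selects L F x β ↔ β ∈ F ∧ ConvEquiv L x β := by
  refine ⟨Selects.convEquiv hF hx, fun hβ => ?_⟩
  have huniq : ∀ γ ∈ F, ConvEquiv L x γ → β = γ := fun γ hγ h =>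
    ((isFingerprint_iff.1 hF).2 x hx).unique hβ ⟨hγ, h⟩
  -- Any selected element is already known to represent `x`, so it suffices that the rule selects
  -- something.
  suffices h : ∃ γ, Selects L F x γ ∧ (ConvEquiv L x γ → γ = β) by
    obtain ⟨γ, h, he⟩ := h
    exact he (h.convEquiv hF hx).2 ▸ h
  have hne : (F : Set (List A)).Nonempty := ⟨β, hβ.1⟩
  by_cases h₁ : ∀ γ ∈ F, ColexLe x γ
  · obtain ⟨m, hm⟩ := exists_isColexMin F.finite_toSet hne
    exact ⟨m, Or.inl ⟨h₁, hm⟩, fun h => (huniq m hm.1 h).symm⟩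
  by_cases h₂ : ∀ γ ∈ F, ColexLe γ x
  · obtain ⟨m, hm⟩ := exists_isColexMax F.finite_toSet hne
    exact ⟨m, Or.inr (Or.inl ⟨h₂, hm⟩), fun h => (huniq m hm.1 h).symm⟩
  push Not at h₁ h₂
  obtain ⟨γ₁, hγ₁, h₁⟩ := h₁
  obtain ⟨γ₂, hγ₂, h₂⟩ := h₂
  obtain ⟨s, hs⟩ := exists_isColexMax (S := {γ | γ ∈ F ∧ ColexLe γ x})
    (F.finite_toSet.subset fun _ h => h.1) ⟨γ₁, hγ₁, (colexLe_total x γ₁).resolve_left h₁⟩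
  obtain ⟨t, ht⟩ := exists_isColexMin (S := {γ | γ ∈ F ∧ ColexLt x γ})
    (F.finite_toSet.subset fun _ h => h.1) ⟨γ₂, hγ₂, (colexLe_or_lt γ₂ x).resolve_left h₂⟩
  have hc : Consecutive F s t := by
    refine ⟨hs.1.1, ht.1.1, hs.1.2.trans_lt ht.1.2, fun γ hγ h => ?_⟩
    rcases colexLe_or_lt γ x with h' | h'
    · exact h.1.not_le (hs.2 γ ⟨hγ, h'⟩)
    · exact h.2.not_le (ht.2 γ ⟨hγ, h'⟩)
  refine ⟨β, Or.inr (Or.inr ⟨s, t, hc, hs.1.2, ht.1.2.le, ?_⟩), fun _ => rfl⟩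
  rcases hc.convEquiv_or hF hs.1.2 ht.1.2.le hx with h | h
  · have hs' := huniq s hs.1.1 h
    by_cases h' : MNEquiv L x t
    · exact Or.inr (Or.inr ⟨h.1.symm, h', Or.inl ⟨h.2.1, hs'⟩⟩)
    · exact Or.inl ⟨h.1.symm, h', hs'⟩
  · have ht' := huniq t ht.1.1 h
    by_cases h' : MNEquiv L s x
    · exact Or.inr (Or.inr ⟨h', h.1, Or.inr ⟨h.2.1, ht'⟩⟩)
    · exact Or.inr (Or.inl ⟨h', h.1, ht'⟩)

theorem ConvEquiv.eq_nil {β : List A} (h : ConvEquiv L [] β) : β = [] :=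
  List.getLast?_eq_none_iff.1 h.2.1.symm

/-- The empty string is alone in its class, having no last letter, so `F` contains it. -/
theorem isColexMin_iff_eq_nil (hF : IsFingerprint L F) (hne : [] ∈ Pref L) {β : List A} :
    IsColexMin (F : Set (List A)) β ↔ β = [] := by
  obtain ⟨ρ, ⟨hρF, hρ⟩, -⟩ := (isFingerprint_iff.1 hF).2 [] hne
  obtain rfl := hρ.eq_nil
  constructor
  · exact fun h => (h.2 [] hρF).antisymm (nil_colexLe _)
  · rintro rfl
    exact ⟨hρF, fun γ _ => nil_colexLe γ⟩

theorem mem_eval_fingerprintAutomaton (hF : IsFingerprint L F) (hne : [] ∈ Pref L)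
    {w : List A} {β : {α // α ∈ F}} :
    β ∈ (fingerprintAutomaton L F).eval w ↔ w ∈ Pref L ∧ ConvEquiv L w β.1 := by
  induction w using List.reverseRecOn generalizing β with
  | nil =>
    change IsColexMin (F : Set (List A)) β.1 ↔ _
    rw [isColexMin_iff_eq_nil hF hne]
    exact ⟨fun h => ⟨hne, h ▸ ConvEquiv.refl _⟩, fun h => h.2.eq_nil⟩
  | append_singleton w c ih =>
    rw [mem_eval_append_singleton]
    constructor
    · rintro ⟨α, hα, hP, hS⟩
      have h := (ih.1 hα).2.append_singleton c
      exact ⟨h.mem_pref_iff.2 hP, h.trans ((selects_iff hF hP).1 hS).2⟩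
    · rintro ⟨hP, hβ⟩
      obtain ⟨ρ, ⟨hρF, hρ⟩, -⟩ := (isFingerprint_iff.1 hF).2 w (mem_pref_of_append hP)
      have h := hρ.append_singleton c
      have hP' := h.mem_pref_iff.1 hP
      exact ⟨⟨ρ, hρF⟩, ih.2 ⟨mem_pref_of_append hP, hρ⟩, hP',
        (selects_iff hF hP').2 ⟨β.2, h.symm.trans hβ⟩⟩

theorem accepts_fingerprintAutomaton (hF : IsFingerprint L F) (hne : [] ∈ Pref L) :
    (fingerprintAutomaton L F).accepts = L := by
  ext w
  constructor
  · rintro ⟨β, hβ, hw⟩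
    exact ((mem_eval_fingerprintAutomaton hF hne).1 hw).2.1.mem_iff.2 hβ
  · intro hw
    have hP : w ∈ Pref L := ⟨[], by simpa using hw⟩
    obtain ⟨ρ, ⟨hρF, hρ⟩, -⟩ := (isFingerprint_iff.1 hF).2 w hP
    exact ⟨⟨ρ, hρF⟩, hρ.1.mem_iff.1 hw, (mem_eval_fingerprintAutomaton hF hne).2 ⟨hP, hρ⟩⟩

theorem isDFA_fingerprintAutomaton (hF : IsFingerprint L F) (hne : [] ∈ Pref L) :
    IsDFA (fingerprintAutomaton L F) := by
  have hF' := isFingerprint_iff.1 hF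
  have hsub : ∀ w, ((fingerprintAutomaton L F).eval w).Subsingleton := fun w β hβ γ hγ => by
    rw [mem_eval_fingerprintAutomaton hF hne] at hβ hγ
    exact Subtype.ext ((hF'.2 w hβ.1).unique ⟨β.2, hβ.2⟩ ⟨γ.2, hγ.2⟩)
  have hmem : ∀ β : {α // α ∈ F}, β ∈ (fingerprintAutomaton L F).eval β.1 := fun β =>
    (mem_eval_fingerprintAutomaton hF hne).2 ⟨hF'.1 _ β.2, ConvEquiv.refl _⟩
  refine ⟨⟨?_, fun β => ⟨β.1, hmem β⟩, fun β => ?_⟩, fun α c β hβ γ hγ => ?_⟩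
  · have hnil := (isColexMin_iff_eq_nil hF hne).2 rfl
    exact ⟨⟨[], hnil.1⟩, (hsub []).eq_singleton_of_mem hnil⟩
  · obtain ⟨γ, hγ⟩ := hF'.1 _ β.2
    rw [← accepts_fingerprintAutomaton hF hne, append_mem_accepts_iff,
      (hsub β.1).eq_singleton_of_mem (hmem β)] at hγ
    exact ⟨γ, hγ⟩
  · have h₁ := (selects_iff hF hβ.1).1 hβ.2
    have h₂ := (selects_iff hF hγ.1).1 hγ.2
    exact Subtype.ext ((hF'.2 _ hβ.1).unique h₁ h₂)

theorem isWheelerOrder_fingerprintAutomaton (hF : IsFingerprint L F) (hne : [] ∈ Pref L) :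
    IsWheelerOrder (fingerprintAutomaton L F) fun α β => ColexLt α.1 β.1 := by
  have hF' := isFingerprint_iff.1 hF
  refine ⟨?_, fun q₀ hq₀ => ⟨fun q hq => ?_, fun q a h => ?_⟩, ?_⟩
  · exact { irrefl := fun a => colexLt_irrefl a.1
            trans := fun _ _ _ => ColexLt.trans
            trichotomous := fun a b h h' =>
              Subtype.ext (((colexLe_or_lt a.1 b.1).resolve_right h').resolve_left h) }
  · exact ((show IsColexMin (F : Set (List A)) q₀.1 from hq₀).2 q.1 q.2).lt_of_ne fun h => hq (Subtype.ext h.symm)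
  · have h₁ := ((selects_iff hF h.1).1 h.2).2.2.1
    rw [(isColexMin_iff_eq_nil hF hne).1 hq₀] at h₁
    simp at h₁
  · intro u₁ u₂ a₁ a₂ v₁ v₂ h₁ h₂
    have hc₁ := ((selects_iff hF h₁.1).1 h₁.2).2
    have hc₂ := ((selects_iff hF h₂.1).1 h₂.2).2
    -- The targets represent the classes of these strings, and distinct classes are ordered like
    -- their members.
    have key : ColexLt (u₁.1 ++ [a₁]) (u₂.1 ++ [a₂]) → ColexLt v₁.1 v₂.1 ∨ v₁ = v₂ := by
      intro h
      refine (hc₁.colexLe hc₂ h₁.1 h₂.1 h.le).imp_right fun h' => Subtype.ext ?_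
      exact (hF'.2 v₁.1 (hF'.1 _ v₁.2)).unique ⟨v₁.2, ConvEquiv.refl _⟩ ⟨v₂.2, h'⟩
    refine ⟨fun ha => ?_, fun h => key (concat_colexLt_concat_iff.2 (Or.inr h))⟩
    refine (key (concat_colexLt_concat_iff.2 (Or.inl ha))).resolve_right fun h => ha.ne ?_
    have := hc₁.2.1.trans ((congrArg (fun v => v.1.getLast?) h).trans hc₂.2.1.symm)
    simpa using this

/-- For minimality, send each element of `F` to a state that it reaches in another WDFA; this is
injective because strings reaching a common state are `ConvEquiv`. -/
theorem isMinWDFA_fingerprintAutomaton (hF : IsFingerprint L F) (hne : [] ∈ Pref L) :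
    IsMinWDFA L (fingerprintAutomaton L F) := by
  have hF' := isFingerprint_iff.1 hF
  refine ⟨⟨isDFA_fingerprintAutomaton hF hne, _, isWheelerOrder_fingerprintAutomaton hF hne⟩,
    accepts_fingerprintAutomaton hF hne, fun ρ _ N ⟨hN, lt, hlt⟩ hNL => ?_⟩
  subst hNL
  have h : ∀ α : {α // α ∈ F}, ∃ q, q ∈ N.eval α.1 := fun α =>
    eval_nonempty_of_mem_pref (hF'.1 _ α.2)
  choose f hf using h
  refine Fintype.card_le_of_injective f fun α β h => Subtype.ext ?_
  exact (hF'.2 α.1 (hF'.1 _ α.2)).unique ⟨α.2, ConvEquiv.refl _⟩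
    ⟨β.2, hlt.convEquiv hN (hf α) (h ▸ hf β)⟩

end Construction

end Wheeler
theorem mainTheorem7 {A : Type*} [Fintype A] [LinearOrder A] {σ : Type*} [Fintype σ]
    (L : Language A) (hL : Wheeler.IsWheelerLanguage L)
    (D : NFA A σ) (hD : Wheeler.IsMinDFA D) (hDL : D.accepts = L) :
    -- there is no infinite run
    (¬ ∃ run : ℕ → Wheeler.Config A,
      run 0 = .start ∧ ∀ i, Wheeler.Step D (run i) (run (i + 1))) ∧
    -- a run never gets stuck before it returns
    (∀ c, Wheeler.Reachable D c → (∃ F, c = .done F) ∨ ∃ c', Wheeler.Step D c c') ∧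
    -- whichever overlapping pairs are chosen, both subroutine calls of the iteration succeed
    (∀ τ, Wheeler.Reachable D (.loop τ) → ∀ p ∈ τ, ∀ p' ∈ τ, Wheeler.Overlap p p' →
      (∃ M₁, Wheeler.IsGreatestSmaller D p.1 p'.1 M₁) ∧
      (∃ m₂, Wheeler.IsSmallestGreater D p.1 p'.1 m₂)) ∧
    -- every returned set is a fingerprint, from which the minimum WDFA is built
    (∀ F, Wheeler.Reachable D (.done F) →
      Wheeler.IsFingerprint L F ∧
      Wheeler.IsMinWDFA L (Wheeler.fingerprintAutomaton L F)) := by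
  have hR := hD.isReduced hDL
  have hnil : [] ∈ Wheeler.Pref L := by
    obtain ⟨q, hq⟩ := hD.1.1.1
    exact hR.mem_pref_iff.2 ⟨q, by change q ∈ D.start; rw [hq]; rfl⟩
  refine ⟨Wheeler.not_exists_infinite_run hR, fun c hc => hc.exists_step hR,
    fun τ hτ p hp p' _ ho => ?_, fun F hF => ?_⟩
  · exact ⟨(hτ.loopInvariant hR).exists_isGreatestSmaller hp ho,
      (hτ.loopInvariant hR).exists_isSmallestGreater hp ho⟩
  · have hfp := hF.isFingerprint hR hL
    exact ⟨hfp, Wheeler.isMinWDFA_fingerprintAutomaton hfp hnil⟩
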